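/- Let $m\ge 3$ be an integer, and let $M\subset\mathbb C^2$ be a connected open neighbourhood of $0$ with coordinates $t=(t_1,t_2)$, $\partial_i=\partial/\partial t_i$, viewed as a representative of the germ at $0$ of the F-manifold $I_2(m)$: the unit field is $e=\partial_1$, $\partial_2\circ\partial_2=t_2^{m-2}\partial_1$, and the Euler field is $E=t_1\partial_1+\frac2m t_2\partial_2$. Its analytic spectrum is $L_M=\{(t,y)\in M\times\mathbb C^2 : y_1=1,\ y_2^2=t_2^{m-2}\}\subset T^*M$, and its bifurcation set $\mathcal K^{bif}$ is the set of points of $M$ at which the eigenvalues of $E\circ$ are not all different. A $(TE)$-structure of rank $2$ on $M$ is a holomorphic vector bundle $H\to\mathbb C\times M$ of rank $2$ (the coordinate on $\mathbb C$ is $z$) with a flat connection $\nabla$ on $H|_{\mathbb C^*\times M}$ which maps $\mathcal O(H)$ to $\bigl(\frac1z\mathcal O_{\mathbb C\times M}\,\Omega^1_M+\frac1{z^2}\mathcal O_{\mathbb C\times M}\,dz\bigr)\otimes\mathcal O(H)$. On $K=H|_{\{0\}\times M}$ let $C_X=[z\nabla_X]$ and $\mathcal U=[z^2\nabla_{\partial_z}]$.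 The $(TE)$-structure is over $I_2(m)$ if a section $\zeta$ of $K$ exists such that $X\mapsto C_X\zeta$ is an isomorphism $TM\to K$, and if $C_XC_Y=C_{X\circ Y}$, $C_e=\mathrm{id}$ and $C_E=-\mathcal U$. For $t^0\in M\setminus\mathcal K^{bif}$, the regular singular exponents over $t^0$ are the numbers $\alpha_1,\alpha_2$ in a formal (in $z$) decomposition of the restriction of $(H,\nabla)$ to $t^0$ into rank $1$ pieces $\nabla=d+(-u_iz^{-2}+\alpha_iz^{-1})\,dz$. The exponent at the point $(t^0,y)\in L_M$ is the $\alpha_i$ for which $u_i$ is the value $y(E)$ at $t^0$. Consider a $(TE)$-structure over $I_2(m)$, and suppose that on $V\times M$, for some open neighbourhood $V$ of $0$ in $\mathbb C$, $H$ has a holomorphic basis $\underline v=(v_1,v_2)$ with $\nabla\underline v=\underline v\,(z^{-1}A_1dt_1+z^{-1}A_2dt_2+z^{-2}B\,dz)$ in the normal form $$A_1=\mathbf 1_2,\qquad A_2=C_2+zf\,\mathcal E,\qquad B=\Bigl(-t_1\mathbf 1_2-\tfrac2mt_2C_2\Bigr)+z\Bigl(\alpha\mathbf 1_2+\tfrac{2-m}{2m}\mathcal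 D-\tfrac2mt_2f\,\mathcal E\Bigr),$$ $$C_2=\begin{pmatrix}0&t_2^{m-2}\\1&0\end{pmatrix},\quad \mathcal D=\begin{pmatrix}1&0\\0&-1\end{pmatrix},\quad \mathcal E=\begin{pmatrix}0&1\\0&0\end{pmatrix},\quad f=\begin{cases}0&(m\text{ odd})\\ \lambda\,t_2^{(m-4)/2}&(m\text{ even})\end{cases}$$ with $\alpha,\lambda\in\mathbb C$. (i) If $m$ is even, then $L_M$ has exactly two irreducible components. The regular singular exponents over every $t^0\in M\setminus\mathcal K^{bif}$ are $\alpha-\frac{\lambda}{m}$ and $\alpha+\frac{\lambda}{m}$ (counted with multiplicity): the exponent is constantly $\alpha-\frac\lambda m$ on one component of $L_M$ and constantly $\alpha+\frac\lambda m$ on the other (at points over $M\setminus\mathcal K^{bif}$). (ii) If $m$ is odd, then $L_M$ has exactly one irreducible component, and $\alpha$ is the only regular singular exponent: over every $t^0\in M\setminus\mathcal K^{bif}$ both exponents equal $\alpha$. -/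

import Mathlib

open scoped Manifold ContDiff Bundle

noncomputable section

namespace TE

/-! ### Analytic sets and their irreducible components -/

section AnalyticSets

variable {V : Type*} [NormedAddCommGroup V] [NormedSpace ℂ V]

/-- `Z` is a (closed) analytic subset of the open set `Ω`: near every point of `Ω` it is the common
zero set of finitely many holomorphic functions. -/
def IsAnalyticSubset (Ω Z : Set V) : Prop :=
  Z ⊆ Ω ∧ ∀ p ∈ Ω, ∃ W : Set V, IsOpen W ∧ p ∈ W ∧ W ⊆ Ω ∧
    ∃ (k : ℕ) (g : Fin k → V → ℂ), (∀ i, AnalyticOnNhd ℂ (g i) W) ∧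
      Z ∩ W = {x ∈ W | ∀ i, g i x = 0}

/-- A nonempty analytic subset of `Ω` which is not the union of two smaller analytic subsets. -/
def IsIrreducibleAnalyticSubset (Ω Z : Set V) : Prop :=
  IsAnalyticSubset Ω Z ∧ Z.Nonempty ∧
    ∀ Z₁ Z₂ : Set V, IsAnalyticSubset Ω Z₁ → IsAnalyticSubset Ω Z₂ →
      Z = Z₁ ∪ Z₂ → Z = Z₁ ∨ Z = Z₂

/-- The irreducible components of a subset `X` of `Ω` (as a reduced complex space): the maximal
irreducible analytic subsets of `Ω` contained in `X`. -/
def components (Ω X : Set V) : Set (Set V) :=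
  {Z | Maximal (fun Y => IsIrreducibleAnalyticSubset Ω Y ∧ Y ⊆ X) Z}

end AnalyticSets

/-! ### Multiplications on the tangent bundle, unit field, Euler field -/

/-- A multiplication on the tangent bundle of (an open subset of) `ℂⁿ` with unit field and
Euler field, in coordinates: `∂ᵢ ∘ ∂ⱼ = ∑ₖ mul t i j k ∂ₖ`, `e = ∑ₖ unit t k ∂ₖ`,
`E = ∑ₖ euler t k ∂ₖ`. -/
structure TangentData (n : ℕ) where
  mul : (Fin n → ℂ) → Fin n → Fin n → Fin n → ℂ
  unit : (Fin n → ℂ) → Fin n → ℂ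
  euler : (Fin n → ℂ) → Fin n → ℂ

/-- The F-manifold `I₂(m)`: `e = ∂₁`, `∂₂ ∘ ∂₂ = t₂^(m-2) ∂₁`, with the Euler field
`E = t₁ ∂₁ + (2/m) t₂ ∂₂`. The coordinates `t₁, t₂` are `t 0, t 1`. -/
def I2 (m : ℕ) : TangentData 2 where
  mul t := ![![![1, 0], ![0, 1]], ![![0, 1], ![t 1 ^ (m - 2), 0]]]
  unit _ := ![1, 0]
  euler t := ![t 0, 2 / (m : ℂ) * t 1]

namespace TangentData

variable {n : ℕ} (F : TangentData n)

/-- The analytic spectrum `L_M ⊆ T^*M = M × ℂⁿ` (as a set), `y` being the fibre coordinates. -/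
def spectrum (M : TopologicalSpace.Opens (Fin n → ℂ)) : Set ((Fin n → ℂ) × (Fin n → ℂ)) :=
  {p | p.1 ∈ M ∧ ∑ k, F.unit p.1 k * p.2 k = 1 ∧
    ∀ i j, p.2 i * p.2 j = ∑ k, F.mul p.1 i j k * p.2 k}

/-- The irreducible components of the analytic spectrum `L_M`. -/
def spectrumComponents (M : TopologicalSpace.Opens (Fin n → ℂ)) :
    Set (Set ((Fin n → ℂ) × (Fin n → ℂ))) :=
  components ((M : Set (Fin n → ℂ)) ×ˢ Set.univ) (F.spectrum M)

/-- The matrix of `E ∘ : T_t M → T_t M` in the basis `∂₁, …, ∂ₙ`. -/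
def eulerMatrix (t : Fin n → ℂ) : Matrix (Fin n) (Fin n) ℂ :=
  Matrix.of fun k j => ∑ i, F.euler t i * F.mul t i j k

/-- The bifurcation set: the points at which the eigenvalues of `E ∘` are not all different. -/
def bifurcationSet (M : TopologicalSpace.Opens (Fin n → ℂ)) : Set (Fin n → ℂ) :=
  {t | t ∈ M ∧ ¬ (F.eulerMatrix t).charpoly.roots.Nodup}

end TangentData

/-! ### (TE)-structures -/

/-- The open subset `ℂ × M` of `ℂ × ℂⁿ`; its points are pairs `(z, t)`. -/
def prodC {n : ℕ} (M : TopologicalSpace.Opens (Fin n → ℂ)) :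
    TopologicalSpace.Opens (ℂ × (Fin n → ℂ)) :=
  ⟨Prod.snd ⁻¹' (M : Set (Fin n → ℂ)), M.isOpen.preimage continuous_snd⟩

/-- The complex manifold `ℂ × M`. -/
abbrev Base {n : ℕ} (M : TopologicalSpace.Opens (Fin n → ℂ)) : Type := prodC M

/-- The point `(z, t)` of `ℂ × M`. -/
def pt {n : ℕ} {M : TopologicalSpace.Opens (Fin n → ℂ)} (z : ℂ) (t : M) : Base M :=
  ⟨(z, (t : Fin n → ℂ)), t.2⟩

section Bundle

variable {n r : ℕ} {M : TopologicalSpace.Opens (Fin n → ℂ)} {H : Base M → Type*}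
  [TopologicalSpace (Bundle.TotalSpace (Fin r → ℂ) H)]
  [∀ x, AddCommGroup (H x)] [∀ x, Module ℂ (H x)] [∀ x, TopologicalSpace (H x)]
  [FiberBundle (Fin r → ℂ) H]

variable (r) in
/-- The section `s` of the rank `r` bundle `H → ℂ × M` is holomorphic on the set `W`. -/
def HolSection (s : ∀ x, H x) (W : Set (Base M)) : Prop :=
  ContMDiffOn 𝓘(ℂ, ℂ × (Fin n → ℂ)) (𝓘(ℂ, ℂ × (Fin n → ℂ)).prod 𝓘(ℂ, Fin r → ℂ)) ω
    (fun x => Bundle.TotalSpace.mk' (Fin r → ℂ) x (s x)) W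

variable (r) in
/-- `v` is a holomorphic basis of the rank `r` bundle `H` on the set `W`. -/
def HolBasis (v : Fin r → ∀ x, H x) (W : Set (Base M)) : Prop :=
  IsLocalFrameOn 𝓘(ℂ, ℂ × (Fin n → ℂ)) (Fin r → ℂ) ω v W

variable (r H) in
/-- A (TE)-structure on the rank `r` holomorphic vector bundle `H → ℂ × M`, i.e. a flat connection
`∇` on `H|_{ℂ^* × M}` with a pole of Poincaré rank 1 along `{0} × M`:
`∇ : 𝓞(H) → (z⁻¹ 𝓞 Ω¹_M + z⁻² 𝓞 dz) ⊗ 𝓞(H)`. It is given by the operators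
`D i = z ∇_{∂ᵢ}` and `Dz = z² ∇_{∂_z}`, which act on the holomorphic sections over open subsets of
`ℂ × M`. (A section over an open set `W` is represented by a function on `ℂ × M` whose values
outside `W` are irrelevant.) -/
structure TEStructure where
  D : Fin n → (∀ x, H x) → ∀ x, H x
  Dz : (∀ x, H x) → ∀ x, H x
  /-- the operators are compatible with restriction to open subsets -/
  D_congr : ∀ (W : Set (Base M)) (s s' : ∀ x, H x), IsOpen W → HolSection r s W →
    (∀ x ∈ W, s x = s' x) → ∀ i, ∀ x ∈ W, D i s x = D i s' x
  Dz_congr : ∀ (W : Set (Base M)) (s s' : ∀ x, H x), IsOpen W → HolSection r s W →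
    (∀ x ∈ W, s x = s' x) → ∀ x ∈ W, Dz s x = Dz s' x
  D_hol : ∀ (W : Set (Base M)) (s : ∀ x, H x), IsOpen W → HolSection r s W →
    ∀ i, HolSection r (D i s) W
  Dz_hol : ∀ (W : Set (Base M)) (s : ∀ x, H x), IsOpen W → HolSection r s W →
    HolSection r (Dz s) W
  D_add : ∀ (W : Set (Base M)) (s s' : ∀ x, H x), IsOpen W → HolSection r s W →
    HolSection r s' W → ∀ i, ∀ x ∈ W, D i (fun x => s x + s' x) x = D i s x + D i s' x
  Dz_add : ∀ (W : Set (Base M)) (s s' : ∀ x, H x), IsOpen W → HolSection r s W →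
    HolSection r s' W → ∀ x ∈ W, Dz (fun x => s x + s' x) x = Dz s x + Dz s' x
  /-- the Leibniz rule for `z ∇_{∂ᵢ}` -/
  D_leibniz : ∀ (W : Set (Base M)) (a : ℂ × (Fin n → ℂ) → ℂ) (s : ∀ x, H x), IsOpen W →
    AnalyticOnNhd ℂ a (Subtype.val '' W) → HolSection r s W → ∀ i, ∀ x ∈ W,
      D i (fun x => a x.1 • s x) x =
        (x.1.1 * fderiv ℂ a x.1 (0, Pi.single i 1)) • s x + a x.1 • D i s x
  /-- the Leibniz rule for `z² ∇_{∂_z}` -/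
  Dz_leibniz : ∀ (W : Set (Base M)) (a : ℂ × (Fin n → ℂ) → ℂ) (s : ∀ x, H x), IsOpen W →
    AnalyticOnNhd ℂ a (Subtype.val '' W) → HolSection r s W → ∀ x ∈ W,
      Dz (fun x => a x.1 • s x) x =
        (x.1.1 ^ 2 * fderiv ℂ a x.1 (1, 0)) • s x + a x.1 • Dz s x
  /-- flatness: `∇_{∂ᵢ} ∇_{∂ⱼ} = ∇_{∂ⱼ} ∇_{∂ᵢ}` -/
  flat : ∀ (W : Set (Base M)) (s : ∀ x, H x), IsOpen W → HolSection r s W →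
    ∀ i j, ∀ x ∈ W, D i (D j s) x = D j (D i s) x
  /-- flatness: `∇_{∂_z} ∇_{∂ᵢ} = ∇_{∂ᵢ} ∇_{∂_z}`; multiplied by `z³` this reads
  `Dz (D i s) - z D i s = D i (Dz s)` -/
  flat_z : ∀ (W : Set (Base M)) (s : ∀ x, H x), IsOpen W → HolSection r s W →
    ∀ i, ∀ x ∈ W, Dz (D i s) x - x.1.1 • D i s x = D i (Dz s) x

namespace TEStructure

variable (S : TEStructure r H)

/-- `S` is a (TE)-structure over the F-manifold `M` with Euler field, given by `F`. On
`K = H|_{z=0}`, the operators `z ∇_{∂ᵢ}` and `z² ∇_{∂_z}` induce the Higgs field `C` and the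
endomorphism `𝒰`. The Higgs bundle is primitive, and it induces the multiplication, the unit field
and the Euler field of `F`, i.e. `C_X C_Y = C_{X ∘ Y}`, `C_e = id`, `C_E = - 𝒰`. -/
structure IsOver (F : TangentData n) : Prop where
  primitive : ∃ (W : Set (Base M)) (s : ∀ x, H x), IsOpen W ∧ (∀ t : M, pt 0 t ∈ W) ∧
    HolSection r s W ∧ ∀ t : M, LinearIndependent ℂ (fun i => S.D i s (pt 0 t)) ∧
      Submodule.span ℂ (Set.range fun i => S.D i s (pt 0 t)) = ⊤
  mul : ∀ (W : Set (Base M)) (s : ∀ x, H x), IsOpen W → HolSection r s W →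
    ∀ t : M, pt 0 t ∈ W → ∀ i j,
      S.D i (S.D j s) (pt 0 t) = ∑ k, F.mul t i j k • S.D k s (pt 0 t)
  unit : ∀ (W : Set (Base M)) (s : ∀ x, H x), IsOpen W → HolSection r s W →
    ∀ t : M, pt 0 t ∈ W → ∑ k, F.unit t k • S.D k s (pt 0 t) = s (pt 0 t)
  euler : ∀ (W : Set (Base M)) (s : ∀ x, H x), IsOpen W → HolSection r s W →
    ∀ t : M, pt 0 t ∈ W → ∑ k, F.euler t k • S.D k s (pt 0 t) = - S.Dz s (pt 0 t)

/-- The matrices of the connection in the basis `v` on `W`: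
`∇ v = v · (∑ᵢ z⁻¹ Aᵢ dtᵢ + z⁻² B dz)`, matrices as functions of `(z, t)`. -/
def HasMatrices (v : Fin r → ∀ x, H x) (W : Set (Base M))
    (A : Fin n → ℂ → (Fin n → ℂ) → Matrix (Fin r) (Fin r) ℂ)
    (B : ℂ → (Fin n → ℂ) → Matrix (Fin r) (Fin r) ℂ) : Prop :=
  ∀ x ∈ W, ∀ j, (∀ i, S.D i (v j) x = ∑ k, A i x.1.1 x.1.2 k j • v k x) ∧
    S.Dz (v j) x = ∑ k, B x.1.1 x.1.2 k j • v k x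

/-- The Taylor series at `0` of a matrix valued function. -/
def taylor (B : ℂ → Matrix (Fin r) (Fin r) ℂ) : Matrix (Fin r) (Fin r) (PowerSeries ℂ) :=
  Matrix.of fun i j => PowerSeries.mk fun k =>
    iteratedDeriv k (fun z => B z i j) 0 / (k.factorial : ℂ)

/-- The restriction of the (TE)-structure to the point `t⁰` of `M` decomposes formally into the
rank 1 (TE)-structures `∇ = d - uᵢ z⁻² dz + αᵢ z⁻¹ dz`: near `(0, t⁰)` there are a holomorphic basis
`w` of `H` with `z² ∇_{∂_z} w = w · B` over `t⁰` and an invertible matrix `T` of formal power series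
in `z` such that `w · T` has the diagonal connection matrix `diag(-uᵢ + αᵢ z)`. -/
def FormallyDecomposes (t₀ : M) (u α : Fin r → ℂ) : Prop :=
  ∃ (W : Set (Base M)) (w : Fin r → ∀ x, H x) (B : ℂ → Matrix (Fin r) (Fin r) ℂ)
    (T : Matrix (Fin r) (Fin r) (PowerSeries ℂ)),
    IsOpen W ∧ pt 0 t₀ ∈ W ∧ HolBasis r w W ∧ (∀ i j, AnalyticAt ℂ (fun z => B z i j) 0) ∧
    (∀ z : ℂ, pt z t₀ ∈ W → ∀ j, S.Dz (w j) (pt z t₀) = ∑ k, B z k j • w k (pt z t₀)) ∧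
    IsUnit T ∧
    (PowerSeries.X ^ 2 : PowerSeries ℂ) • T.map (PowerSeries.derivative ℂ) + taylor B * T =
      T * Matrix.diagonal fun i => PowerSeries.C (-u i) + PowerSeries.C (α i) * PowerSeries.X

/-- The regular singular exponents of the (TE)-structure over `t⁰` are the elements of the
multiset `R`: a formal decomposition exists, and each one has these exponents. -/
def HasExponents (t₀ : M) (R : Multiset ℂ) : Prop :=
  (∃ u α, S.FormallyDecomposes t₀ u α) ∧
    ∀ u α, S.FormallyDecomposes t₀ u α → Finset.univ.val.map α = R

/-- `β` is the regular singular exponent at the point `(t⁰, y)` of the analytic spectrum: it belongs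
to the rank 1 piece whose eigenvalue `uᵢ` of `E ∘` is the value `y(E)` at that sheet. -/
def IsExponentAt (F : TangentData n) (t₀ : M) (y : Fin n → ℂ) (β : ℂ) : Prop :=
  ∃ u α, S.FormallyDecomposes t₀ u α ∧ ∃ i, u i = ∑ k, F.euler t₀ k * y k ∧ α i = β

/-- `𝒜^rse(Z) = β`: the regular singular exponent at the points of the component `Z` of `L_M`
outside the bifurcation set is (well-defined and) constantly `β`. -/
def ExponentOn (F : TangentData n) (Z : Set ((Fin n → ℂ) × (Fin n → ℂ))) (β : ℂ) : Prop :=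
  (∃ p ∈ Z, p.1 ∈ M ∧ p.1 ∉ F.bifurcationSet M) ∧
    ∀ (t : M) (y : Fin n → ℂ), ((t : Fin n → ℂ), y) ∈ Z →
      (t : Fin n → ℂ) ∉ F.bifurcationSet M → ∀ γ, S.IsExponentAt F t y γ ↔ γ = β

end TEStructure

end Bundle

/-! ### The normal form over `I₂(m)` -/

/-- The function `f` in the normal form: `0` if `m` is odd, `lam · t₂^((m-4)/2)` if `m` is even. -/
def normalF (m : ℕ) (lam : ℂ) (t : Fin 2 → ℂ) : ℂ :=
  if Even m then lam * t 1 ^ ((m - 4) / 2) else 0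

/-- The matrix `C₂`. -/
def matC2 (m : ℕ) (t : Fin 2 → ℂ) : Matrix (Fin 2) (Fin 2) ℂ := !![0, t 1 ^ (m - 2); 1, 0]

/-- The matrix `D`. -/
def matD : Matrix (Fin 2) (Fin 2) ℂ := !![1, 0; 0, -1]

/-- The matrix `E`. -/
def matE : Matrix (Fin 2) (Fin 2) ℂ := !![0, 1; 0, 0]

/-- The matrices `A₁ = 1` and `A₂ = C₂ + z f E`. -/
def normalA (m : ℕ) (lam : ℂ) : Fin 2 → ℂ → (Fin 2 → ℂ) → Matrix (Fin 2) (Fin 2) ℂ :=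
  ![fun _ _ => 1, fun z t => matC2 m t + (z * normalF m lam t) • matE]

/-- The matrix `B = (-t₁ - (2/m) t₂ C₂) + z (α + (2-m)/(2m) D - (2/m) t₂ f E)`. -/
def normalB (m : ℕ) (α lam : ℂ) (z : ℂ) (t : Fin 2 → ℂ) : Matrix (Fin 2) (Fin 2) ℂ :=
  ((-t 0) • (1 : Matrix (Fin 2) (Fin 2) ℂ) - (2 / (m : ℂ) * t 1) • matC2 m t) +
    z • (α • (1 : Matrix (Fin 2) (Fin 2) ℂ) + ((2 - (m : ℂ)) / (2 * (m : ℂ))) • matD +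
      (-2 / (m : ℂ) * t 1 * normalF m lam t) • matE)

end TE

end

/-! Exponents. Fix `t` with `t₂ ≠ 0`, i.e. off the bifurcation set, and a square root `s` of
`t₂^(m-2)`. Over `t` the connection matrix is `b₀ + z b₁`, and the eigenvectors `(±s, 1)` of `matC2`
diagonalize `b₀` with distinct eigenvalues. A formal gauge transformation then removes the
off-diagonal terms order by order, so the exponents are the diagonal entries of `b₁` in this
eigenbasis. There `matD` is purely off-diagonal, while `matE` contributes to the diagonal; the
exponent at the sheet `y₂ = s` is `α - t₂ f / (m s)` (`exists_isFormalGauge_linear`,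
`formallyDecomposes_normalForm`).

Uniqueness. A gauge transformation between two diagonal forms has invertible constant term, which
forces them to agree up to a permutation (`exists_perm_of_isFormalGauge`). Different holomorphic
bases differ by an analytic gauge transformation, and Taylor expansion makes it formal, so the
choice of basis is harmless (`FormallyDecomposes.exists_perm`).

Spectrum. For even `m` the sheets are `s = ±t₂^((m-2)/2)`, and `t₂ f = λ t₂^((m-2)/2)` cancels
against `s`, leaving `α ∓ λ/m`. Each sheet is a graph over the connected set `M`, hence irreducible
by the identity theorem. For odd `m`, `f = 0` leaves `α` alone, and `L_M` is the image of `(t₁, s) ↦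
((t₁, s²), (1, s^(m-2)))` on a double covering of `M`. This covering is connected because it
branches over `0 ∈ M`, so `L_M` is irreducible. -/

namespace TE

/-! ### Analytic subsets, irreducibility and components. -/

section AnalyticSets

variable {V : Type*} [NormedAddCommGroup V] [NormedSpace ℂ V]

theorem IsAnalyticSubset.inter {Ω Z₁ Z₂ : Set V} (h₁ : IsAnalyticSubset Ω Z₁)
    (h₂ : IsAnalyticSubset Ω Z₂) : IsAnalyticSubset Ω (Z₁ ∩ Z₂) := by
  refine ⟨fun x hx => h₁.1 hx.1, fun p hp => ?_⟩
  obtain ⟨W₁, hW₁, hp₁, hs₁, k₁, g₁, hg₁, he₁⟩ := h₁.2 p hp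
  obtain ⟨W₂, hW₂, hp₂, hs₂, k₂, g₂, hg₂, he₂⟩ := h₂.2 p hp
  refine ⟨W₁ ∩ W₂, hW₁.inter hW₂, ⟨hp₁, hp₂⟩, fun x hx => hs₁ hx.1, k₁ + k₂,
    Fin.append g₁ g₂, ?_, ?_⟩
  · intro i
    refine Fin.addCases (fun i => ?_) (fun i => ?_) i
    · simpa using (hg₁ i).mono Set.inter_subset_left
    · simpa using (hg₂ i).mono Set.inter_subset_right
  · ext x
    have e₁ := Set.ext_iff.1 he₁ x
    have e₂ := Set.ext_iff.1 he₂ x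
    simp only [Set.mem_inter_iff, Set.mem_ofPred_eq] at e₁ e₂ ⊢
    have : (∀ i, Fin.append g₁ g₂ i x = 0) ↔ (∀ i, g₁ i x = 0) ∧ ∀ i, g₂ i x = 0 := by
      constructor
      · intro h
        exact ⟨fun i => by simpa using h (Fin.castAdd _ i),
          fun i => by simpa using h (Fin.natAdd _ i)⟩
      · rintro ⟨h, h'⟩ i
        refine Fin.addCases (fun i => ?_) (fun i => ?_) i
        · simpa using h i
        · simpa using h' i
    rw [this]
    tauto

/-- The zero set of finitely many functions holomorphic on `Ω` is an analytic subset. -/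
theorem isAnalyticSubset_zeros {Ω : Set V} (hΩ : IsOpen Ω) {k : ℕ} (g : Fin k → V → ℂ)
    (hg : ∀ i, AnalyticOnNhd ℂ (g i) Ω) : IsAnalyticSubset Ω {x ∈ Ω | ∀ i, g i x = 0} :=
  ⟨fun _ hx => hx.1, fun p hp => ⟨Ω, hΩ, hp, subset_rfl, k, g, hg, by
    ext x; simp only [Set.mem_inter_iff, Set.mem_ofPred_eq]; tauto⟩⟩

/-- Some local equation is nonzero at `p` and, by continuity, nearby: analytic subsets are
relatively closed. -/
theorem IsAnalyticSubset.exists_isOpen_compl {Ω Z : Set V} (h : IsAnalyticSubset Ω Z) {p : V}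
    (hp : p ∈ Ω) (hpZ : p ∉ Z) : ∃ W, IsOpen W ∧ p ∈ W ∧ W ⊆ Ω ∧ Disjoint W Z := by
  obtain ⟨W, hW, hpW, hs, k, g, hg, he⟩ := h.2 p hp
  have : ∃ i, g i p ≠ 0 := by
    by_contra! hc
    exact hpZ ((Set.ext_iff.1 he p).2 ⟨hpW, hc⟩).1
  obtain ⟨i, hi⟩ := this
  refine ⟨W ∩ g i ⁻¹' {0}ᶜ, (hg i).continuousOn.isOpen_inter_preimage hW isOpen_compl_singleton,
    ⟨hpW, hi⟩, fun x hx => hs hx.1, ?_⟩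
  rw [Set.disjoint_left]
  intro x hx hxZ
  exact hx.2 (((Set.ext_iff.1 he x).1 ⟨hxZ, hx.1⟩).2 i)

/-- The preimage of an analytic subset under a holomorphic map is an analytic subset. -/
theorem IsAnalyticSubset.preimage {V' : Type*} [NormedAddCommGroup V'] [NormedSpace ℂ V']
    {Ω Z : Set V} (h : IsAnalyticSubset Ω Z) {D : Set V'} (hD : IsOpen D) {φ : V' → V}
    (hφ : AnalyticOnNhd ℂ φ D) (hm : Set.MapsTo φ D Ω) : IsAnalyticSubset D (D ∩ φ ⁻¹' Z) := by
  refine ⟨Set.inter_subset_left, fun p hp => ?_⟩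
  obtain ⟨W, hW, hpW, hs, k, g, hg, he⟩ := h.2 (φ p) (hm hp)
  refine ⟨D ∩ φ ⁻¹' W, hφ.continuousOn.isOpen_inter_preimage hD hW, ⟨hp, hpW⟩,
    Set.inter_subset_left, k, fun i x => g i (φ x), ?_, ?_⟩
  · intro i x hx
    exact (hg i (φ x) hx.2).comp (hφ x hx.1)
  · ext x
    have e := Set.ext_iff.1 he (φ x)
    simp only [Set.mem_inter_iff, Set.mem_ofPred_eq, Set.mem_preimage] at e ⊢
    tauto

/-- An analytic subset of a connected open set which has an interior point is everything. -/
theorem IsAnalyticSubset.eq_of_interior_nonempty {D Z : Set V} (h : IsAnalyticSubset D Z)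
    (hD : IsPreconnected D) (hi : (interior Z).Nonempty) : Z = D := by
  refine subset_antisymm h.1 ?_
  suffices D ⊆ interior Z from this.trans interior_subset
  obtain ⟨q, hq⟩ := hi
  -- The interior is relatively closed in `D`: near a limit point `p` the local equations vanish
  -- around some point of a ball about `p`, hence on the whole ball by the identity theorem.
  refine hD.subset_of_closure_inter_subset isOpen_interior ⟨q, h.1 (interior_subset hq), hq⟩ ?_
  rintro p ⟨hpc, hpD⟩
  obtain ⟨W, hW, hpW, hs, k, g, hg, he⟩ := h.2 p hpD
  obtain ⟨ε, hε, hball⟩ := Metric.isOpen_iff.1 hW p hpW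
  obtain ⟨x, hxb, hxi⟩ := mem_closure_iff.1 hpc _ Metric.isOpen_ball (Metric.mem_ball_self hε)
  have hsub : Metric.ball p ε ⊆ Z := by
    intro y hy
    refine ((Set.ext_iff.1 he y).2 ⟨hball hy, fun i => ?_⟩).1
    refine ((hg i).mono hball).eqOn_zero_of_preconnected_of_eventuallyEq_zero
      (convex_ball p ε).isPreconnected hxb ?_ hy
    filter_upwards [isOpen_interior.mem_nhds hxi, Metric.isOpen_ball.mem_nhds hxb] with w hw hwb
    exact ((Set.ext_iff.1 he w).1 ⟨interior_subset hw, hball hwb⟩).2 i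
  exact mem_interior.2 ⟨_, hsub, Metric.isOpen_ball, Metric.mem_ball_self hε⟩

/-- A connected open set is not the union of two proper analytic subsets. -/
theorem eq_or_eq_of_union_eq {D Z₁ Z₂ : Set V} (hD : IsPreconnected D)
    (h₁ : IsAnalyticSubset D Z₁) (h₂ : IsAnalyticSubset D Z₂) (h : D ⊆ Z₁ ∪ Z₂) :
    Z₁ = D ∨ Z₂ = D := by
  by_contra! hc
  have hsub : ¬ D ⊆ Z₁ := fun hs => hc.1 (subset_antisymm h₁.1 hs)
  obtain ⟨p, hpD, hp⟩ := Set.not_subset.1 hsub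
  obtain ⟨W, hW, hpW, hWD, hdis⟩ := h₁.exists_isOpen_compl hpD hp
  refine hc.2 (h₂.eq_of_interior_nonempty hD ⟨p, mem_interior.2 ⟨W, fun x hx => ?_, hW, hpW⟩⟩)
  exact (h (hWD hx)).resolve_left (Set.disjoint_left.1 hdis hx)

/-- An analytic subset which is the image of a connected open set under a holomorphic map is
irreducible. -/
theorem isIrreducibleAnalyticSubset_image {V' : Type*} [NormedAddCommGroup V'] [NormedSpace ℂ V']
    {Ω : Set V} {D : Set V'} (hDo : IsOpen D) (hD : IsConnected D) {φ : V' → V}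
    (hφ : AnalyticOnNhd ℂ φ D) (h : IsAnalyticSubset Ω (φ '' D)) :
    IsIrreducibleAnalyticSubset Ω (φ '' D) := by
  refine ⟨h, hD.nonempty.image φ, fun Z₁ Z₂ h₁ h₂ he => ?_⟩
  have hm : Set.MapsTo φ D Ω := fun x hx => h.1 ⟨x, hx, rfl⟩
  have key := eq_or_eq_of_union_eq hD.isPreconnected (h₁.preimage hDo hφ hm)
    (h₂.preimage hDo hφ hm) (fun x hx => by
      have : φ x ∈ Z₁ ∪ Z₂ := he ▸ ⟨x, hx, rfl⟩
      exact this.imp (fun h => ⟨hx, h⟩) (fun h => ⟨hx, h⟩))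
  refine key.imp (fun hk => ?_) (fun hk => ?_)
  · refine subset_antisymm ?_ (he ▸ Set.subset_union_left)
    rintro _ ⟨x, hx, rfl⟩
    exact (hk.symm ▸ hx : x ∈ D ∩ φ ⁻¹' Z₁).2
  · refine subset_antisymm ?_ (he ▸ Set.subset_union_right)
    rintro _ ⟨x, hx, rfl⟩
    exact (hk.symm ▸ hx : x ∈ D ∩ φ ⁻¹' Z₂).2

theorem components_of_isIrreducible {Ω X : Set V} (h : IsIrreducibleAnalyticSubset Ω X) :
    components Ω X = {X} := by
  ext Z
  simp only [components, Set.mem_ofPred_eq, Set.mem_singleton_iff]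
  constructor
  · intro hZ
    exact subset_antisymm hZ.prop.2 (hZ.2 ⟨h, subset_rfl⟩ hZ.prop.2)
  · rintro rfl
    exact ⟨⟨h, subset_rfl⟩, fun Y hY _ => hY.2⟩

/-- An irreducible `Y` inside the union is `(Y ∩ X₁) ∪ (Y ∩ X₂)`, so it lies in one of the two
pieces; the non-inclusions make both pieces maximal. -/
theorem components_union {Ω X₁ X₂ : Set V} (h₁ : IsIrreducibleAnalyticSubset Ω X₁)
    (h₂ : IsIrreducibleAnalyticSubset Ω X₂) (h₁₂ : ¬ X₁ ⊆ X₂) (h₂₁ : ¬ X₂ ⊆ X₁) :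
    components Ω (X₁ ∪ X₂) = {X₁, X₂} := by
  have key : ∀ Y, IsIrreducibleAnalyticSubset Ω Y → Y ⊆ X₁ ∪ X₂ → Y ⊆ X₁ ∨ Y ⊆ X₂ := by
    intro Y hY hs
    have := hY.2.2 (Y ∩ X₁) (Y ∩ X₂) (hY.1.inter h₁.1) (hY.1.inter h₂.1) (by
      rw [← Set.inter_union_distrib_left, Set.inter_eq_left.2 hs])
    exact this.imp (fun h => Set.inter_eq_left.1 h.symm) (fun h => Set.inter_eq_left.1 h.symm)
  ext Z
  simp only [components, Set.mem_ofPred_eq, Set.mem_insert_iff, Set.mem_singleton_iff]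
  constructor
  · intro hZ
    rcases key Z hZ.prop.1 hZ.prop.2 with h | h
    · exact Or.inl (subset_antisymm h (hZ.2 ⟨h₁, Set.subset_union_left⟩ h))
    · exact Or.inr (subset_antisymm h (hZ.2 ⟨h₂, Set.subset_union_right⟩ h))
  · rintro (rfl | rfl)
    · refine ⟨⟨h₁, Set.subset_union_left⟩, fun Y hY hle => ?_⟩
      rcases key Y hY.1 hY.2 with h | h
      · exact h
      · exact absurd (hle.trans h) h₁₂
    · refine ⟨⟨h₂, Set.subset_union_right⟩, fun Y hY hle => ?_⟩
      rcases key Y hY.1 hY.2 with h | h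
      · exact absurd (hle.trans h) h₂₁
      · exact h

end AnalyticSets

/-! ### Connectedness of branched double coverings. -/

/-- A branched double covering of a connected set is connected if it has a branch point. Here
`σ` is the covering involution. -/
theorem isPreconnected_preimage_of_branch {X Y : Type*} [TopologicalSpace X] [TopologicalSpace Y]
    {q : X → Y} (hq : IsOpenMap q) (hqc : Continuous q) {σ : X → X} (hσ : Continuous σ)
    (hfib : ∀ x x', q x = q x' ↔ x' = x ∨ x' = σ x) (hsurj : Function.Surjective q)
    {x₀ : X} (hx₀ : σ x₀ = x₀) {D : Set Y} (hDo : IsOpen D) (hD : IsPreconnected D)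
    (h₀ : q x₀ ∈ D) : IsPreconnected (q ⁻¹' D) := by
  have hqσ : ∀ x, q (σ x) = q x := fun x => ((hfib x (σ x)).2 (Or.inr rfl)).symm
  have hσσ : ∀ x, σ (σ x) = x ∨ σ x = x := fun x => by
    rcases (hfib (σ x) x).1 (hqσ x) with h | h
    · exact Or.inr h.symm
    · exact Or.inl h.symm
  have aux : ∀ u v : Set X, IsOpen u → IsOpen v → q ⁻¹' D ⊆ u ∪ v →
      ¬ (q ⁻¹' D ∩ (u ∩ v)).Nonempty → x₀ ∈ u → ¬ (q ⁻¹' D ∩ v).Nonempty := by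
    rintro u v hu hv hcov hdis hxu ⟨x, hxD, hxv⟩
    have hDo' := hDo.preimage hqc
    -- Cover `D` by two open images: the points whose whole fibre lies in `u`, and the points having
    -- a preimage in `v`. The branch point makes the first nonempty, so they meet, and a common
    -- point yields an element of `u ∩ v`.
    obtain ⟨y, hyD, ⟨a, ⟨haD, hau, haσ⟩, hay⟩, ⟨b, ⟨hbD, hbv⟩, hby⟩⟩ :=
      hD (q '' (q ⁻¹' D ∩ (u ∩ σ ⁻¹' u))) (q '' (q ⁻¹' D ∩ v))
        (hq _ (hDo'.inter (hu.inter (hu.preimage hσ)))) (hq _ (hDo'.inter hv)) (by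
          intro y hy
          obtain ⟨w, rfl⟩ := hsurj y
          have hwσ : σ w ∈ q ⁻¹' D := by rw [Set.mem_preimage, hqσ]; exact hy
          rcases hcov (show w ∈ q ⁻¹' D from hy) with h | h
          · rcases hcov hwσ with h' | h'
            · exact Or.inl ⟨w, ⟨hy, h, h'⟩, rfl⟩
            · exact Or.inr ⟨σ w, ⟨hwσ, h'⟩, hqσ w⟩
          · exact Or.inr ⟨w, ⟨hy, h⟩, rfl⟩)
        ⟨q x₀, h₀, x₀, ⟨h₀, hxu, by rwa [Set.mem_preimage, hx₀]⟩, rfl⟩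
        ⟨q x, hxD, x, ⟨hxD, hxv⟩, rfl⟩
    have hbu : b ∈ u := by
      rcases (hfib a b).1 (hay.trans hby.symm) with rfl | rfl
      · exact hau
      · exact haσ
    exact hdis ⟨b, hbD, hbu, hbv⟩
  intro u v hu hv hcov hnu hnv
  by_contra hdis
  rcases hcov (show x₀ ∈ q ⁻¹' D from h₀) with h | h
  · exact aux u v hu hv hcov hdis h hnv
  · exact aux v u hv hu (by rwa [Set.union_comm]) (by rwa [Set.inter_comm v u]) h hnu

/-! ### Formal gauge transformations and diagonalization. -/

section Formal

open PowerSeries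

variable {r : ℕ}

theorem map_derivative_mul (P T : Matrix (Fin r) (Fin r) (PowerSeries ℂ)) :
    (P * T).map (PowerSeries.derivative ℂ) =
      P.map (PowerSeries.derivative ℂ) * T + P * T.map (PowerSeries.derivative ℂ) := by
  ext1 i j
  simp only [Matrix.map_apply, Matrix.mul_apply, Matrix.add_apply, map_sum, Derivation.leibniz,
    ← Finset.sum_add_distrib, smul_eq_mul]
  exact Finset.sum_congr rfl fun k _ => by ring

/-- `P` is a formal gauge transformation from `B` to `B'`: if `z² ∇_{∂_z} w = w B` then
`z² ∇_{∂_z} (w P) = (w P) B'`. -/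
def IsFormalGauge (B P B' : Matrix (Fin r) (Fin r) (PowerSeries ℂ)) : Prop :=
  (X ^ 2 : PowerSeries ℂ) • P.map (PowerSeries.derivative ℂ) + B * P = P * B'

theorem IsFormalGauge.mul {B P B' T B'' : Matrix (Fin r) (Fin r) (PowerSeries ℂ)}
    (h : IsFormalGauge B P B') (h' : IsFormalGauge B' T B'') : IsFormalGauge B (P * T) B'' := by
  unfold IsFormalGauge at *
  rw [map_derivative_mul, mul_assoc, ← h', mul_add, ← mul_assoc P B' T, ← h, add_mul, smul_add,
    Matrix.smul_mul, Matrix.mul_smul, mul_assoc]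
  abel

/-- Two diagonalizations `P` and `P * T` of the same `B` are thereby compared directly, through `T`.
-/
theorem IsFormalGauge.of_mul {B P B' T B'' : Matrix (Fin r) (Fin r) (PowerSeries ℂ)}
    (hP : IsUnit P) (h : IsFormalGauge B P B') (h' : IsFormalGauge B (P * T) B'') :
    IsFormalGauge B' T B'' := by
  unfold IsFormalGauge at *
  refine hP.mul_left_cancel ?_
  rw [mul_add, ← mul_assoc P B' T, ← h, ← mul_assoc P T, ← h', map_derivative_mul, add_mul,
    smul_add, Matrix.smul_mul, Matrix.mul_smul, mul_assoc]
  abel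

/-- The connection matrix `diag(-uᵢ + αᵢ z)`. -/
noncomputable def diagMatrix (u α : Fin r → ℂ) : Matrix (Fin r) (Fin r) (PowerSeries ℂ) :=
  Matrix.diagonal fun i => C (-u i) + C (α i) * X

/-- The diagonal form of a connection matrix is unique up to a permutation. -/
theorem exists_perm_of_isFormalGauge {u α u' α' : Fin r → ℂ}
    {R : Matrix (Fin r) (Fin r) (PowerSeries ℂ)} (hR : IsUnit R)
    (h : IsFormalGauge (diagMatrix u α) R (diagMatrix u' α')) :
    ∃ σ : Equiv.Perm (Fin r), u' = u ∘ σ ∧ α' = α ∘ σ := by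
  -- In the `(i, j)` entry of the gauge equation the derivative term has order at least 2. The
  -- constant term therefore compares eigenvalues; once these cancel, the coefficient of `X`
  -- compares exponents.
  have hentry : ∀ i j, constantCoeff (R i j) ≠ 0 → u' j = u i ∧ α' j = α i := by
    intro i j hij
    have e := congrFun (congrFun h i) j
    simp only [diagMatrix, Matrix.add_apply, Matrix.smul_apply, Matrix.diagonal_mul,
      Matrix.mul_diagonal, smul_eq_mul, Matrix.map_apply] at e
    have hu : u' j = u i := by
      have e0 := congrArg constantCoeff e
      simp only [map_add, map_mul, map_pow, constantCoeff_X, constantCoeff_C] at e0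
      have : constantCoeff (R i j) * (u' j - u i) = 0 := by linear_combination e0
      exact sub_eq_zero.1 ((mul_eq_zero.1 this).resolve_left hij)
    refine ⟨hu, ?_⟩
    rw [hu] at e
    have e' : X * (X * derivative ℂ (R i j)) + X * (C (α i) * R i j) =
        X * (C (α' j) * R i j) := by linear_combination e
    rw [← mul_add] at e'
    have e1 := congrArg constantCoeff (mul_left_cancel₀ X_ne_zero e')
    simp only [map_add, map_mul, constantCoeff_X, constantCoeff_C] at e1
    have : constantCoeff (R i j) * (α' j - α i) = 0 := by linear_combination -e1
    exact sub_eq_zero.1 ((mul_eq_zero.1 this).resolve_left hij)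
  -- A nonzero term in the Leibniz expansion of `det R(0)` provides the permutation.
  have hdet : (R.map constantCoeff).det ≠ 0 := by
    have := ((Matrix.isUnit_iff_isUnit_det R).1 hR).map (constantCoeff (R := ℂ))
    rw [RingHom.map_det] at this
    exact this.ne_zero
  rw [Matrix.det_apply] at hdet
  obtain ⟨σ, -, hσ⟩ := Finset.exists_ne_zero_of_sum_ne_zero hdet
  have hprod : ∏ i, (R.map constantCoeff) (σ i) i ≠ 0 := fun h => hσ (by rw [h, smul_zero])
  rw [Finset.prod_ne_zero_iff] at hprod
  have hk := fun i => hentry (σ i) i (hprod i (Finset.mem_univ i))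
  exact ⟨σ, funext fun i => (hk i).1, funext fun i => (hk i).2⟩

/-- The coefficients of a formal solution of a rank 2 system in diagonal leading form. -/
noncomputable def splitCoeff (c d δ w : ℂ) : ℕ → ℂ × ℂ
  | 0 => (1, 0)
  | k + 1 =>
    let b := -(d * (splitCoeff c d δ w k).1 + (δ + k) * (splitCoeff c d δ w k).2) / w
    (-c * b / (k + 1), b)

theorem splitCoeff_succ_snd (c d δ w : ℂ) (k : ℕ) : (splitCoeff c d δ w (k + 1)).2 =
    -(d * (splitCoeff c d δ w k).1 + (δ + k) * (splitCoeff c d δ w k).2) / w := rfl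

/-- `(a, b)` is a column of the diagonalizing matrix: `c, d` are off-diagonal entries of the second
coefficient, `δ` is a difference of its diagonal entries and `w` one of eigenvalues. The second
equation determines the next coefficient of `b` because `w ≠ 0`; the first, divided by `X`, then
determines that of `a`. -/
theorem exists_split (c d δ : ℂ) {w : ℂ} (hw : w ≠ 0) :
    ∃ a b : PowerSeries ℂ, constantCoeff a = 1 ∧ constantCoeff b = 0 ∧
      X ^ 2 * derivative ℂ a + C c * X * b = 0 ∧
      X ^ 2 * derivative ℂ b + C w * b + C d * X * a + C δ * X * b = 0 := by
  refine ⟨mk fun k => (splitCoeff c d δ w k).1, mk fun k => (splitCoeff c d δ w k).2,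
    by simp [constantCoeff_mk, splitCoeff], by simp [constantCoeff_mk, splitCoeff], ?_, ?_⟩
  · rw [pow_two, mul_assoc, mul_comm (C c), mul_assoc, ← mul_add]
    refine mul_eq_zero_of_right _ ?_
    ext k
    cases k with
    | zero => simp [splitCoeff, constantCoeff_mk]
    | succ k =>
      have : (k : ℂ) + 1 ≠ 0 := Nat.cast_add_one_ne_zero k
      simp [coeff_succ_X_mul, coeff_derivative, splitCoeff]
      field_simp
      ring
  · ext k
    cases k with
    | zero => simp [splitCoeff, constantCoeff_mk]
    | succ k =>
      rw [pow_two, mul_assoc, mul_assoc (C d), mul_assoc (C δ)]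
      simp only [map_add, coeff_succ_X_mul, coeff_C_mul, coeff_mk]
      cases k with
      | zero => simp [splitCoeff]; field_simp; ring
      | succ k =>
        rw [coeff_succ_X_mul, coeff_derivative, coeff_mk,
          splitCoeff_succ_snd _ _ _ _ (k + 1), map_zero]
        push_cast
        field_simp
        ring

/-- A rank 2 connection matrix with a regular semisimple diagonal leading term can be formally
diagonalized; the exponents are the diagonal entries of the second coefficient. -/
theorem exists_isFormalGauge_diag (u : Fin 2 → ℂ) (hu : u 0 ≠ u 1)
    (N : Matrix (Fin 2) (Fin 2) ℂ) :
    ∃ T, IsUnit T ∧ IsFormalGauge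
      ((Matrix.diagonal fun i => -u i).map C + (X : PowerSeries ℂ) • N.map C) T
      (diagMatrix u fun i => N i i) := by
  obtain ⟨a, b, ha, hb, h₁, h₂⟩ := exists_split (N 0 1) (N 1 0) (N 1 1 - N 0 0)
    (sub_ne_zero.2 hu)
  obtain ⟨a', b', ha', hb', h₁', h₂'⟩ := exists_split (N 1 0) (N 0 1) (N 0 0 - N 1 1)
    (sub_ne_zero.2 hu.symm)
  -- The second column solves the same problem with the two indices exchanged; the constant term is
  -- the identity.
  refine ⟨!![a, b'; b, a'], ?_, ?_⟩
  · rw [Matrix.isUnit_iff_isUnit_det, Matrix.det_fin_two_of, isUnit_iff_constantCoeff]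
    simp [ha, hb, ha', hb']
  · unfold IsFormalGauge diagMatrix
    simp only [map_sub] at h₂ h₂'
    ext1 i j
    fin_cases i <;> fin_cases j <;>
      simp [Matrix.mul_apply, Fin.sum_univ_two, Matrix.diagonal]
    · linear_combination h₁
    · linear_combination h₂'
    · linear_combination h₂
    · linear_combination h₁'

/-- A rank 2 connection matrix `b₀ + z b₁` with `b₀` regular semisimple can be formally
diagonalized. -/
theorem exists_isFormalGauge_linear (u : Fin 2 → ℂ) (hu : u 0 ≠ u 1)
    {b₀ b₁ P N : Matrix (Fin 2) (Fin 2) ℂ} (hP : IsUnit P)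
    (h₀ : b₀ * P = P * Matrix.diagonal fun i => -u i) (h₁ : b₁ * P = P * N) :
    ∃ T, IsUnit T ∧ IsFormalGauge (b₀.map C + (X : PowerSeries ℂ) • b₁.map C) T
      (diagMatrix u fun i => N i i) := by
  obtain ⟨T, hT, hg⟩ := exists_isFormalGauge_diag u hu N
  refine ⟨P.map C * T, ?_, IsFormalGauge.mul ?_ hg⟩
  · exact (hP.map (RingHom.mapMatrix (C (R := ℂ)))).mul hT
  · unfold IsFormalGauge
    have hd : (P.map (C (R := ℂ))).map (derivative ℂ) = 0 := by
      ext1 i j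
      simp [derivative_C]
    rw [hd, smul_zero, zero_add, add_mul, mul_add, Matrix.smul_mul, Matrix.mul_smul,
      ← Matrix.map_mul, ← Matrix.map_mul, ← Matrix.map_mul, ← Matrix.map_mul, h₀, h₁]

end Formal

/-! ### From analytic to formal gauge equations. -/

section Taylor

open PowerSeries Filter Topology

/-- The Taylor series at `0` of a function. -/
noncomputable def taylorSeries (f : ℂ → ℂ) : PowerSeries ℂ :=
  PowerSeries.mk fun k => iteratedDeriv k f 0 / (k.factorial : ℂ)

theorem taylor_apply {r : ℕ} (B : ℂ → Matrix (Fin r) (Fin r) ℂ) (i j : Fin r) :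
    TEStructure.taylor B i j = taylorSeries fun z => B z i j := rfl

theorem taylorSeries_congr {f g : ℂ → ℂ} (h : f =ᶠ[𝓝 0] g) : taylorSeries f = taylorSeries g := by
  ext k
  simp [taylorSeries, h.iteratedDeriv_eq k]

theorem taylorSeries_add {f g : ℂ → ℂ} (hf : AnalyticAt ℂ f 0) (hg : AnalyticAt ℂ g 0) :
    taylorSeries (fun z => f z + g z) = taylorSeries f + taylorSeries g := by
  ext k
  simp [taylorSeries, iteratedDeriv_fun_add hf.contDiffAt hg.contDiffAt, add_div]

theorem taylorSeries_mul {f g : ℂ → ℂ} (hf : AnalyticAt ℂ f 0) (hg : AnalyticAt ℂ g 0) :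
    taylorSeries (fun z => f z * g z) = taylorSeries f * taylorSeries g := by
  ext k
  simp only [taylorSeries, coeff_mk, iteratedDeriv_fun_mul hf.contDiffAt hg.contDiffAt, coeff_mul,
    Finset.Nat.sum_antidiagonal_eq_sum_range_succ_mk, Nat.succ_eq_add_one, Finset.sum_div]
  refine Finset.sum_congr rfl fun i hi ↦ ?_
  rw [Nat.cast_choose _ (by grind)]
  field_simp [Nat.factorial_ne_zero]

theorem taylorSeries_const (c : ℂ) : taylorSeries (fun _ => c) = C c := by
  ext k
  simp only [taylorSeries, coeff_mk, iteratedDeriv_const, coeff_C]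
  split_ifs with h <;> simp [h]

theorem taylorSeries_id : taylorSeries (fun z => z) = X := by
  ext k
  simp only [taylorSeries, coeff_mk, coeff_X]
  rcases k with _ | _ | k
  · simp
  · simp
  · simp [iteratedDeriv_succ', iteratedDeriv_const]

theorem taylorSeries_sum {ι : Type*} (s : Finset ι) {f : ι → ℂ → ℂ}
    (hf : ∀ i, AnalyticAt ℂ (f i) 0) :
    taylorSeries (fun z => ∑ i ∈ s, f i z) = ∑ i ∈ s, taylorSeries (f i) := by
  classical
  induction s using Finset.induction_on with
  | empty => simp [taylorSeries_const]
  | insert a s ha ih =>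
    simp only [Finset.sum_insert ha]
    rw [taylorSeries_add (hf a) (s.analyticAt_fun_sum fun i _ => hf i), ih]

theorem derivative_taylorSeries (f : ℂ → ℂ) :
    derivative ℂ (taylorSeries f) = taylorSeries (deriv f) := by
  ext k
  have : (k : ℂ) + 1 ≠ 0 := Nat.cast_add_one_ne_zero k
  have h : (k.factorial : ℂ) ≠ 0 := by exact_mod_cast k.factorial_ne_zero
  simp only [coeff_derivative, taylorSeries, coeff_mk, iteratedDeriv_succ', Nat.factorial_succ]
  push_cast
  field_simp

theorem constantCoeff_taylorSeries (f : ℂ → ℂ) : constantCoeff (taylorSeries f) = f 0 := by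
  simp [← coeff_zero_eq_constantCoeff_apply, taylorSeries]

variable {r : ℕ}

/-- Taylor expansion at `0` respects sums, products and derivatives of analytic germs, so it carries
the differential equation to power series. -/
theorem isFormalGauge_taylor {B P B' : ℂ → Matrix (Fin r) (Fin r) ℂ}
    (hB : ∀ i j, AnalyticAt ℂ (fun z => B z i j) 0)
    (hP : ∀ i j, AnalyticAt ℂ (fun z => P z i j) 0)
    (hB' : ∀ i j, AnalyticAt ℂ (fun z => B' z i j) 0)
    (h : ∀ᶠ z in 𝓝 0, ∀ i j, z ^ 2 * deriv (fun z => P z i j) z + (B z * P z) i j =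
      (P z * B' z) i j) :
    IsFormalGauge (TEStructure.taylor B) (TEStructure.taylor P) (TEStructure.taylor B') := by
  unfold IsFormalGauge
  ext1 i j
  simp only [Matrix.add_apply, Matrix.smul_apply, Matrix.map_apply, Matrix.mul_apply, taylor_apply,
    smul_eq_mul, derivative_taylorSeries]
  have hz : taylorSeries (fun z : ℂ => z ^ 2) = X ^ 2 := by
    simp only [pow_two]
    rw [taylorSeries_mul (by fun_prop) (by fun_prop), taylorSeries_id]
  rw [← hz, ← taylorSeries_mul (by fun_prop) (hP i j).deriv]
  simp_rw [← fun k => taylorSeries_mul (hB i k) (hP k j),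
    ← fun k => taylorSeries_mul (hP i k) (hB' k j)]
  rw [← taylorSeries_sum _ fun k => (hB i k).fun_mul (hP k j),
    ← taylorSeries_sum _ fun k => (hP i k).fun_mul (hB' k j),
    ← taylorSeries_add ((by fun_prop : AnalyticAt ℂ (fun z : ℂ => z ^ 2) 0).fun_mul (hP i j).deriv)
      (Finset.univ.analyticAt_fun_sum fun k _ => (hB i k).fun_mul (hP k j))]
  refine taylorSeries_congr ?_
  filter_upwards [h] with z hz
  simpa only [Matrix.mul_apply] using hz i j

theorem isUnit_taylor {P : ℂ → Matrix (Fin r) (Fin r) ℂ} (h : IsUnit (P 0)) :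
    IsUnit (TEStructure.taylor P) := by
  rw [Matrix.isUnit_iff_isUnit_det, isUnit_iff_constantCoeff, RingHom.map_det]
  convert (Matrix.isUnit_iff_isUnit_det _).1 h using 2
  ext i j
  exact constantCoeff_taylorSeries _

theorem taylor_linear (b₀ b₁ : Matrix (Fin r) (Fin r) ℂ) :
    TEStructure.taylor (fun z => b₀ + z • b₁) = b₀.map C + (X : PowerSeries ℂ) • b₁.map C := by
  ext1 i j
  simp only [taylor_apply, Matrix.add_apply, Matrix.smul_apply, smul_eq_mul, Matrix.map_apply]
  rw [taylorSeries_add (by fun_prop) (by fun_prop), taylorSeries_mul (by fun_prop) (by fun_prop),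
    taylorSeries_const, taylorSeries_const, taylorSeries_id]

end Taylor

/-! ### Change of basis and uniqueness of the exponents. -/

section Bundle

open Filter Topology

variable {n r : ℕ} {M : TopologicalSpace.Opens (Fin n → ℂ)} {H : Base M → Type*}
  [TopologicalSpace (Bundle.TotalSpace (Fin r → ℂ) H)]
  [∀ x, AddCommGroup (H x)] [∀ x, Module ℂ (H x)] [∀ x, TopologicalSpace (H x)]
  [FiberBundle (Fin r → ℂ) H]

/-- A holomorphic function on an open subset of `ℂ × M` is the restriction of a function of the
coordinates which is analytic there. -/
theorem exists_analyticOnNhd_of_contMDiffOn {W : Set (Base M)} (hW : IsOpen W) {g : Base M → ℂ}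
    (hg : ContMDiffOn 𝓘(ℂ, ℂ × (Fin n → ℂ)) 𝓘(ℂ, ℂ) ω g W) :
    ∃ a : ℂ × (Fin n → ℂ) → ℂ, AnalyticOnNhd ℂ a (Subtype.val '' W) ∧
      ∀ x : Base M, a x.1 = g x := by
  refine ⟨Function.extend Subtype.val g 0, ?_, fun x => Subtype.val_injective.extend_apply g 0 x⟩
  rintro _ ⟨x, hx, rfl⟩
  have h := hg.contMDiffAt (hW.mem_nhds hx)
  have e : g = fun x : Base M => Function.extend Subtype.val g 0 (x : ℂ × (Fin n → ℂ)) :=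
    funext fun x => (Subtype.val_injective.extend_apply g 0 x).symm
  rw [e] at h
  exact (contMDiffAt_iff_contDiffAt.1 (contMDiffAt_subtype_iff.1 h)).analyticAt

/-- The coefficients are supplied as analytic functions of the ambient coordinates `(z, t)`, the
form in which the Leibniz rules of `TEStructure` accept them. -/
theorem exists_localFrame [VectorBundle ℂ (Fin r → ℂ) H]
    [ContMDiffVectorBundle ω (Fin r → ℂ) H 𝓘(ℂ, ℂ × (Fin n → ℂ))] (x₀ : Base M) :
    ∃ (U : Set (Base M)) (f : Fin r → ∀ x, H x), IsOpen U ∧ x₀ ∈ U ∧ HolBasis r f U ∧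
      ∀ (W : Set (Base M)) (s : ∀ x, H x), IsOpen W → W ⊆ U → HolSection r s W →
        ∃ a : Fin r → ℂ × (Fin n → ℂ) → ℂ, (∀ k, AnalyticOnNhd ℂ (a k) (Subtype.val '' W)) ∧
          ∀ x ∈ W, s x = ∑ k, a k x.1 • f k x := by
  let e := trivializationAt (Fin r → ℂ) H x₀
  let b := Pi.basisFun ℂ (Fin r)
  refine ⟨e.baseSet, e.localFrame b, e.open_baseSet,
    FiberBundle.mem_baseSet_trivializationAt' x₀,
    e.isLocalFrameOn_localFrame_baseSet 𝓘(ℂ, ℂ × (Fin n → ℂ)) ω b, ?_⟩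
  intro W s hW hWU hs
  have hc := fun k => contMDiffOn_localFrameCoeff (I := 𝓘(ℂ, ℂ × (Fin n → ℂ))) b hW hWU hs k
  choose a ha hae using fun k => exists_analyticOnNhd_of_contMDiffOn hW (hc k)
  refine ⟨a, ha, fun x hx => ?_⟩
  simp only [hae]
  exact e.eq_sum_localFrameCoeff_smul (I := 𝓘(ℂ, ℂ × (Fin n → ℂ))) (hWU hx)

theorem HolSection.sum [VectorBundle ℂ (Fin r → ℂ) H] {ι : Type*} (σ : Finset ι)
    {s : ι → ∀ x, H x} {W : Set (Base M)} (hs : ∀ i, HolSection r (s i) W) :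
    HolSection r (fun x => ∑ i ∈ σ, s i x) W :=
  ContMDiffOn.sum_section fun i _ => hs i

theorem HolSection.smul [VectorBundle ℂ (Fin r → ℂ) H] {W : Set (Base M)}
    {a : ℂ × (Fin n → ℂ) → ℂ} (ha : AnalyticOnNhd ℂ a (Subtype.val '' W))
    {s : ∀ x, H x} (hs : HolSection r s W) : HolSection r (fun x => a x.1 • s x) W := by
  have : ContMDiffOn 𝓘(ℂ, ℂ × (Fin n → ℂ)) 𝓘(ℂ, ℂ) ω (fun x : Base M => a x.1) W := fun x hx =>
    (contMDiffAt_subtype_iff.2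
      (contMDiffAt_iff_contDiffAt.2 (ha x.1 ⟨x, hx, rfl⟩).contDiffAt)).contMDiffWithinAt
  exact this.smul_section hs

namespace TEStructure

variable (S : TEStructure r H)

theorem Dz_sum [VectorBundle ℂ (Fin r → ℂ) H] {ι : Type*} (σ : Finset ι) {s : ι → ∀ x, H x}
    {W : Set (Base M)} (hW : IsOpen W) (hs : ∀ i, HolSection r (s i) W) {x : Base M} (hx : x ∈ W) :
    S.Dz (fun x => ∑ i ∈ σ, s i x) x = ∑ i ∈ σ, S.Dz (s i) x := by
  classical
  induction σ using Finset.induction_on with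
  | empty =>
    have h0 : HolSection r (fun x : Base M => (0 : H x)) W := by
      simpa using HolSection.sum (∅ : Finset ι) hs
    -- Additivity on `0 + 0` forces `Dz 0 = 0`.
    simpa using S.Dz_add W _ _ hW h0 h0 x hx
  | insert i σ hi ih =>
    simp only [Finset.sum_insert hi]
    rw [S.Dz_add W _ _ hW (hs i) (HolSection.sum σ hs) x hx, ih]

/-- The change of the connection matrix under a change of the basis. -/
theorem matrix_change [VectorBundle ℂ (Fin r → ℂ) H] {W : Set (Base M)} (hW : IsOpen W)
    {f w : Fin r → ∀ x, H x} (hf : HolBasis r f W) (hw : ∀ j, HolSection r (w j) W)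
    {a : Fin r → Fin r → ℂ × (Fin n → ℂ) → ℂ}
    (ha : ∀ k j, AnalyticOnNhd ℂ (a k j) (Subtype.val '' W))
    (hwf : ∀ j, ∀ x ∈ W, w j x = ∑ k, a k j x.1 • f k x) {x : Base M} (hx : x ∈ W)
    {b B : Matrix (Fin r) (Fin r) ℂ} (hb : ∀ j, S.Dz (f j) x = ∑ k, b k j • f k x)
    (hB : ∀ j, S.Dz (w j) x = ∑ k, B k j • w k x) (i j : Fin r) :
    x.1.1 ^ 2 * fderiv ℂ (a i j) x.1 (1, 0) + (b * Matrix.of fun k l => a k l x.1) i j =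
      ((Matrix.of fun k l => a k l x.1) * B) i j := by
  -- `Dz (w j)` is expanded in the frame `f` twice, by the Leibniz rule and through `B`; linear
  -- independence then compares coefficients.
  have h₁ : S.Dz (w j) x =
      ∑ k, (x.1.1 ^ 2 * fderiv ℂ (a k j) x.1 (1, 0) + ∑ l, b k l * a l j x.1) • f k x := by
    rw [S.Dz_congr W _ _ hW (hw j) (hwf j) x hx,
      S.Dz_sum Finset.univ hW (fun k => HolSection.smul (ha k j) (hf.contMDiffOn k)) hx]
    simp_rw [fun k => S.Dz_leibniz W (a k j) (f k) hW (ha k j) (hf.contMDiffOn k) x hx, hb,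
      add_smul, Finset.sum_add_distrib, Finset.sum_smul, Finset.smul_sum, smul_smul]
    rw [Finset.sum_comm]
    simp_rw [mul_comm]
  have h₂ : S.Dz (w j) x = ∑ k, (∑ l, a k l x.1 * B l j) • f k x := by
    rw [hB j]
    simp_rw [fun k => hwf k x hx, Finset.smul_sum, Finset.sum_smul, smul_smul]
    rw [Finset.sum_comm]
    simp_rw [mul_comm]
  have h₃ := Fintype.linearIndependent_iff.1 (hf.linearIndependent hx)
    (fun k => (x.1.1 ^ 2 * fderiv ℂ (a k j) x.1 (1, 0) + ∑ l, b k l * a l j x.1) -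
      ∑ l, a k l x.1 * B l j) (by
        simp_rw [sub_smul]
        rw [Finset.sum_sub_distrib, ← h₁, ← h₂, sub_self]) i
  simpa [Matrix.mul_apply] using sub_eq_zero.1 h₃

theorem analyticAt_slice {a : ℂ × (Fin n → ℂ) → ℂ} {z : ℂ} {t : Fin n → ℂ}
    (ha : AnalyticAt ℂ a (z, t)) : AnalyticAt ℂ (fun z => a (z, t)) z :=
  ha.comp (f := fun z : ℂ => (z, t)) (analyticAt_id.prod analyticAt_const)

theorem deriv_slice {a : ℂ × (Fin n → ℂ) → ℂ} {z : ℂ} {t : Fin n → ℂ}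
    (ha : AnalyticAt ℂ a (z, t)) : deriv (fun z => a (z, t)) z = fderiv ℂ a (z, t) (1, 0) := by
  have h : HasDerivAt (fun z : ℂ => (z, t)) (1, 0) z :=
    (hasDerivAt_id z).prodMk (hasDerivAt_const z t)
  exact (ha.differentiableAt.hasFDerivAt.comp_hasDerivAt z h).deriv

theorem eventually_pt_mem {W : Set (Base M)} (hW : IsOpen W) {t₀ : M} (h : pt 0 t₀ ∈ W) :
    ∀ᶠ z in 𝓝 (0 : ℂ), pt z t₀ ∈ W := by
  have hc : Continuous fun z : ℂ => pt z t₀ :=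
    Continuous.subtype_mk (by fun_prop) _
  exact hc.continuousAt.eventually (hW.mem_nhds h)

/-- All formal decompositions over `t₀` can be computed from a single connection matrix. -/
theorem exists_matrix_of_formallyDecomposes [VectorBundle ℂ (Fin r → ℂ) H]
    [ContMDiffVectorBundle ω (Fin r → ℂ) H 𝓘(ℂ, ℂ × (Fin n → ℂ))] (t₀ : M) :
    ∃ Q : Matrix (Fin r) (Fin r) (PowerSeries ℂ), ∀ u α, S.FormallyDecomposes t₀ u α →
      ∃ T, IsUnit T ∧ IsFormalGauge Q T (diagMatrix u α) := by
  obtain ⟨U, f, hU, h0U, hf, hco⟩ := exists_localFrame (r := r) (H := H) (pt 0 t₀)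
  choose b hba hbe using fun j =>
    hco U (S.Dz (f j)) hU subset_rfl (S.Dz_hol U _ hU (hf.contMDiffOn j))
  refine ⟨taylor fun z => Matrix.of fun k l => b l k (z, t₀), ?_⟩
  rintro u α ⟨W, w, B, T, hW, h0W, hw, hB, hwB, hT, hTg⟩
  have hw' : ∀ j, HolSection r (w j) (W ∩ U) := fun j =>
    ContMDiffOn.mono (hw.contMDiffOn j) Set.inter_subset_left
  have hWU := hW.inter hU
  choose a haa hae using fun j => hco (W ∩ U) (w j) hWU Set.inter_subset_right (hw' j)
  have h0 : pt 0 t₀ ∈ W ∩ U := ⟨h0W, h0U⟩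
  refine ⟨taylor (fun z => Matrix.of fun k l => a l k (z, t₀)) * T, IsUnit.mul ?_ hT,
    IsFormalGauge.mul (B' := taylor B) ?_ hTg⟩
  -- A kernel vector of the transition matrix at `z = 0` would be a linear relation among the basis
  -- vectors `w` over `(0, t₀)`.
  · refine isUnit_taylor (Matrix.mulVec_injective_iff_isUnit.1 ?_)
    rw [← Matrix.coe_mulVecLin, ← LinearMap.ker_eq_bot, LinearMap.ker_eq_bot']
    intro v hv
    refine funext fun j => Fintype.linearIndependent_iff.1 (hw.linearIndependent h0W) v ?_ j
    simp_rw [fun k => hae k _ h0, Finset.smul_sum, smul_smul]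
    rw [Finset.sum_comm]
    simp_rw [← Finset.sum_smul]
    refine Finset.sum_eq_zero fun k _ => ?_
    have hk := congrFun hv k
    simp only [Matrix.mulVecLin_apply, Matrix.mulVec, dotProduct, Matrix.of_apply,
      Pi.zero_apply] at hk
    have : ∑ i, v i * a i k (pt 0 t₀).1 = 0 :=
      (Finset.sum_congr rfl fun i _ => mul_comm _ _).trans hk
    rw [this, zero_smul]
  · refine isFormalGauge_taylor
      (fun i j => analyticAt_slice (hba j i _ ⟨_, h0U, rfl⟩))
      (fun i j => analyticAt_slice (haa j i _ ⟨_, h0, rfl⟩)) hB ?_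
    filter_upwards [eventually_pt_mem hWU h0] with z hz i j
    have := S.matrix_change hWU (hf.mono Set.inter_subset_right) hw'
      (fun k j => haa j k) hae hz (b := Matrix.of fun k l => b l k (z, t₀)) (B := B z)
      (fun j => hbe j _ hz.2) (hwB z hz.1) i j
    have hd := deriv_slice (haa j i _ ⟨_, hz, rfl⟩ : AnalyticAt ℂ (a j i) (z, t₀))
    simp only [Matrix.of_apply]
    rw [hd]
    exact this

/-- The formal decomposition over `t₀` is unique up to a permutation. -/
theorem FormallyDecomposes.exists_perm [VectorBundle ℂ (Fin r → ℂ) H]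
    [ContMDiffVectorBundle ω (Fin r → ℂ) H 𝓘(ℂ, ℂ × (Fin n → ℂ))] {S : TEStructure r H} {t₀ : M}
    {u α u' α' : Fin r → ℂ} (h : S.FormallyDecomposes t₀ u α)
    (h' : S.FormallyDecomposes t₀ u' α') :
    ∃ σ : Equiv.Perm (Fin r), u' = u ∘ σ ∧ α' = α ∘ σ := by
  obtain ⟨Q, hQ⟩ := S.exists_matrix_of_formallyDecomposes t₀
  obtain ⟨T, hT, hg⟩ := hQ u α h
  obtain ⟨T', hT', hg'⟩ := hQ u' α' h'
  -- Since `T` is invertible, `T' = T * R`, and `R` is a gauge transformation between the two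
  -- diagonal forms.
  obtain ⟨R, rfl⟩ := hT.dvd (a := T')
  exact exists_perm_of_isFormalGauge ((hT.mul_left_iff).1 hT') (hg.of_mul hT hg')

end TEStructure

end Bundle

/-! ### Bifurcation set and components of the spectrum of `I2 m`. -/

section Spectrum

open Filter Topology

variable {M : TopologicalSpace.Opens (Fin 2 → ℂ)}

theorem mem_spectrum_I2 {m : ℕ} {p : (Fin 2 → ℂ) × (Fin 2 → ℂ)} :
    p ∈ (I2 m).spectrum M ↔ p.1 ∈ M ∧ p.2 0 = 1 ∧ p.2 1 ^ 2 = p.1 1 ^ (m - 2) := by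
  simp only [TangentData.spectrum, I2, Fin.sum_univ_two, Fin.forall_fin_two, Set.mem_ofPred_eq]
  simp only [Matrix.cons_val_zero, Matrix.cons_val_one, one_mul, zero_mul, add_zero, zero_add]
  constructor
  · rintro ⟨h₁, h₂, -, -, h₃⟩
    rw [h₂, mul_one, ← pow_two] at h₃
    exact ⟨h₁, h₂, h₃⟩
  · rintro ⟨h₁, h₂, h₃⟩
    rw [h₂, mul_one, mul_one, mul_one, one_mul, ← pow_two]
    exact ⟨h₁, rfl, ⟨rfl, rfl⟩, rfl, h₃⟩

/-- With `s² = t₂^(m-2)` the eigenvalues of `E ∘` are `t₁ ± (2/m) t₂ s`. Their difference `(4/m) t₂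
s` vanishes exactly when `t₂ = 0`. -/
theorem not_mem_bifurcationSet_I2 {m : ℕ} (hm : m ≠ 0) {t : Fin 2 → ℂ} (ht : t ∈ M) :
    t ∉ (I2 m).bifurcationSet M ↔ t 1 ≠ 0 := by
  obtain ⟨s, hs⟩ := IsAlgClosed.exists_pow_nat_eq (t 1 ^ (m - 2)) (n := 2) two_pos
  have hmat : (I2 m).eulerMatrix t =
      !![t 0, 2 / (m : ℂ) * t 1 * t 1 ^ (m - 2); 2 / (m : ℂ) * t 1, t 0] := by
    ext i j
    fin_cases i <;> fin_cases j <;>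
      simp [TangentData.eulerMatrix, I2, Fin.sum_univ_two]
  have hchar : ((I2 m).eulerMatrix t).charpoly =
      (Polynomial.X - Polynomial.C (t 0 + 2 / (m : ℂ) * t 1 * s)) *
        (Polynomial.X - Polynomial.C (t 0 - 2 / (m : ℂ) * t 1 * s)) := by
    rw [Matrix.charpoly_fin_two, hmat, Matrix.det_fin_two_of, Matrix.trace_fin_two_of, ← hs]
    simp only [map_add, map_sub, map_mul, map_pow]
    ring
  have hroots : ((I2 m).eulerMatrix t).charpoly.roots =
      {t 0 + 2 / (m : ℂ) * t 1 * s, t 0 - 2 / (m : ℂ) * t 1 * s} := by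
    rw [hchar, Polynomial.roots_mul (mul_ne_zero (Polynomial.X_sub_C_ne_zero _)
      (Polynomial.X_sub_C_ne_zero _)), Polynomial.roots_X_sub_C, Polynomial.roots_X_sub_C]
    rfl
  have hm' : (m : ℂ) ≠ 0 := Nat.cast_ne_zero.2 hm
  simp only [TangentData.bifurcationSet, Set.mem_ofPred_eq, ht, true_and, not_not, hroots]
  rw [Multiset.insert_eq_cons, Multiset.nodup_cons]
  simp only [Multiset.mem_singleton, Multiset.nodup_singleton, and_true]
  constructor
  · rintro h h1
    exact h (by simp [h1])
  · intro h1 he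
    have hs0 : s ≠ 0 := by
      rintro rfl
      exact pow_ne_zero (m - 2) h1 (by simpa using hs.symm)
    have : 4 / (m : ℂ) * t 1 * s = 0 := by linear_combination he
    simp [hm', h1, hs0] at this

theorem exists_mem_ne_zero (h0 : (0 : Fin 2 → ℂ) ∈ M) : ∃ t ∈ M, t 1 ≠ 0 := by
  have hc : Continuous fun z : ℂ => (![0, z] : Fin 2 → ℂ) := by
    refine continuous_pi fun i => ?_
    fin_cases i
    · exact continuous_const
    · exact continuous_id
  have h : ∀ᶠ z in 𝓝 (0 : ℂ), (![0, z] : Fin 2 → ℂ) ∈ M := by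
    refine hc.continuousAt.eventually (M.isOpen.mem_nhds ?_)
    have h : (![0, 0] : Fin 2 → ℂ) = 0 := by
      ext i
      fin_cases i <;> rfl
    simpa only [h, SetLike.mem_coe] using h0
  obtain ⟨z, hz, hz0⟩ := ((h.filter_mono nhdsWithin_le_nhds).and
    (self_mem_nhdsWithin (s := ({0}ᶜ : Set ℂ)))).exists
  exact ⟨_, hz, hz0⟩

theorem isOpen_cotangent : IsOpen ((M : Set (Fin 2 → ℂ)) ×ˢ (Set.univ : Set (Fin 2 → ℂ))) :=
  M.isOpen.prod isOpen_univ

/-- The graph `y = (1, c t₂^k)` in the cotangent bundle of `M`. -/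
def branch (M : TopologicalSpace.Opens (Fin 2 → ℂ)) (k : ℕ) (c : ℂ) :
    Set ((Fin 2 → ℂ) × (Fin 2 → ℂ)) :=
  (fun t => (t, ![1, c * t 1 ^ k])) '' (M : Set (Fin 2 → ℂ))

theorem mem_branch {k : ℕ} {c : ℂ} {p : (Fin 2 → ℂ) × (Fin 2 → ℂ)} :
    p ∈ branch M k c ↔ p.1 ∈ M ∧ p.2 0 = 1 ∧ p.2 1 = c * p.1 1 ^ k := by
  constructor
  · rintro ⟨t, ht, rfl⟩
    exact ⟨ht, rfl, rfl⟩
  · rintro ⟨h₁, h₂, h₃⟩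
    refine ⟨p.1, h₁, Prod.ext rfl (funext fun i => ?_)⟩
    fin_cases i
    · exact h₂.symm
    · exact h₃.symm

theorem isIrreducible_branch (hM : IsConnected (M : Set (Fin 2 → ℂ))) (k : ℕ) (c : ℂ) :
    IsIrreducibleAnalyticSubset ((M : Set (Fin 2 → ℂ)) ×ˢ Set.univ) (branch M k c) := by
  refine isIrreducibleAnalyticSubset_image M.isOpen hM ?_ ?_
  · intro t _
    refine analyticAt_id.prod (analyticAt_pi_iff.2 fun i => ?_)
    fin_cases i
    · exact analyticAt_const
    · exact ContDiffAt.analyticAt (by dsimp; fun_prop)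
  · change IsAnalyticSubset _ (branch M k c)
    convert isAnalyticSubset_zeros (isOpen_cotangent (M := M))
      ![fun p => p.2 0 - 1, fun p => p.2 1 - c * p.1 1 ^ k] ?_ using 1
    · ext p
      simp [mem_branch, Fin.forall_fin_two, sub_eq_zero]
    · intro i p _
      fin_cases i <;> exact ContDiffAt.analyticAt (by dsimp; fun_prop)

theorem not_branch_subset (h0 : (0 : Fin 2 → ℂ) ∈ M) (k : ℕ) {c d : ℂ} (hcd : c ≠ d) :
    ¬ branch M k c ⊆ branch M k d := by
  intro h
  obtain ⟨t, ht, ht1⟩ := exists_mem_ne_zero h0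
  have := (mem_branch.1 (h ⟨t, ht, rfl⟩)).2.2
  exact hcd (mul_right_cancel₀ (pow_ne_zero k ht1) this)

theorem spectrumComponents_even (hM : IsConnected (M : Set (Fin 2 → ℂ)))
    (h0 : (0 : Fin 2 → ℂ) ∈ M) (k : ℕ) :
    (I2 (2 * k + 4)).spectrumComponents M = {branch M (k + 1) 1, branch M (k + 1) (-1)} := by
  have hne : (1 : ℂ) ≠ -1 := by norm_num
  rw [← components_union (isIrreducible_branch hM _ _) (isIrreducible_branch hM _ _)
    (not_branch_subset h0 _ hne) (not_branch_subset h0 _ hne.symm), TangentData.spectrumComponents]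
  congr 1
  ext p
  rw [Set.mem_union, mem_branch, mem_branch, mem_spectrum_I2,
    show 2 * k + 4 - 2 = (k + 1) * 2 by omega, pow_mul, sq_eq_sq_iff_eq_or_eq_neg, one_mul,
    neg_one_mul]
  tauto

/-- The double covering `(t₁, s) ↦ (t₁, s²)` of the plane. -/
def squareSnd : (Fin 2 → ℂ) → (Fin 2 → ℂ) := Pi.map ![id, fun s => s ^ 2]

theorem squareSnd_eq (x : Fin 2 → ℂ) : squareSnd x = ![x 0, x 1 ^ 2] := by
  ext i
  fin_cases i <;> rfl

theorem isOpenMap_sq : IsOpenMap fun s : ℂ => s ^ 2 := by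
  refine (AnalyticOnNhd.is_constant_or_isOpenMap (g := fun s : ℂ => s ^ 2)
    (fun s _ => by fun_prop)).resolve_left ?_
  rintro ⟨w, hw⟩
  have h := (hw 0).trans (hw 1).symm
  norm_num at h

theorem isOpenMap_squareSnd : IsOpenMap squareSnd := by
  refine IsOpenMap.piMap (fun i => ?_) (by simp)
  fin_cases i
  · exact IsOpenMap.id
  · exact isOpenMap_sq

theorem contDiff_squareSnd : ContDiff ℂ ω squareSnd := by
  refine contDiff_pi.2 fun i => ?_
  fin_cases i
  · exact contDiff_apply ℂ ℂ 0
  · exact (contDiff_apply ℂ ℂ 1).pow 2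

/-- The involution `(t₁, s) ↦ (t₁, -s)` fixes the origin, which lies over `0 ∈ M`. For a set
avoiding `t₂ = 0` the preimage could split. -/
theorem isConnected_preimage_squareSnd (hM : IsConnected (M : Set (Fin 2 → ℂ)))
    (h0 : (0 : Fin 2 → ℂ) ∈ M) : IsConnected (squareSnd ⁻¹' (M : Set (Fin 2 → ℂ))) := by
  have hq0 : squareSnd 0 = 0 := by
    ext i
    fin_cases i <;> simp [squareSnd_eq]
  have h0' : squareSnd 0 ∈ (M : Set (Fin 2 → ℂ)) := by rwa [hq0]
  refine ⟨⟨0, h0'⟩, isPreconnected_preimage_of_branch (σ := fun x => ![x 0, -x 1]) (x₀ := 0)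
    isOpenMap_squareSnd contDiff_squareSnd.continuous ?_ ?_ ?_ ?_ M.isOpen hM.isPreconnected h0'⟩
  · refine continuous_pi fun i => ?_
    fin_cases i
    · exact continuous_apply 0
    · exact (continuous_apply 1).neg
  · intro x x'
    simp only [squareSnd_eq, funext_iff, Fin.forall_fin_two, Matrix.cons_val_zero,
      Matrix.cons_val_one, sq_eq_sq_iff_eq_or_eq_neg]
    grind
  · intro y
    obtain ⟨s, hs⟩ := IsAlgClosed.exists_pow_nat_eq (y 1) (n := 2) two_pos
    refine ⟨![y 0, s], ?_⟩
    rw [squareSnd_eq]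
    ext i
    fin_cases i
    · rfl
    · exact hs
  · ext i
    fin_cases i <;> simp

theorem isIrreducible_spectrum_odd (hM : IsConnected (M : Set (Fin 2 → ℂ)))
    (h0 : (0 : Fin 2 → ℂ) ∈ M) (k : ℕ) :
    IsIrreducibleAnalyticSubset ((M : Set (Fin 2 → ℂ)) ×ˢ Set.univ)
      ((I2 (2 * k + 3)).spectrum M) := by
  have hm : 2 * k + 3 - 2 = 2 * k + 1 := by omega
  have himage : (I2 (2 * k + 3)).spectrum M =
      (fun x => (squareSnd x, ![1, x 1 ^ (2 * k + 1)])) ''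
        (squareSnd ⁻¹' (M : Set (Fin 2 → ℂ))) := by
    ext p
    rw [mem_spectrum_I2, hm]
    constructor
    · rintro ⟨h₁, h₂, h₃⟩
      -- A square root of `t₂` yields `y₂` only up to sign; replacing `s` by `-s` corrects it
      -- because the power is odd.
      have key : ∃ s, s ^ 2 = p.1 1 ∧ s ^ (2 * k + 1) = p.2 1 := by
        obtain ⟨s, hs⟩ := IsAlgClosed.exists_pow_nat_eq (p.1 1) (n := 2) two_pos
        rw [← hs, ← pow_mul, mul_comm, pow_mul, sq_eq_sq_iff_eq_or_eq_neg] at h₃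
        rcases h₃ with h₃ | h₃
        · exact ⟨s, hs, h₃.symm⟩
        · exact ⟨-s, by rw [neg_sq, hs], by rw [Odd.neg_pow ⟨k, rfl⟩, h₃]⟩
      obtain ⟨s, hs, hs'⟩ := key
      have hq : squareSnd ![p.1 0, s] = p.1 := by
        rw [squareSnd_eq]
        ext i
        fin_cases i
        · rfl
        · exact hs
      refine ⟨![p.1 0, s], ?_, Prod.ext hq (funext fun i => ?_)⟩
      · rw [Set.mem_preimage, hq]
        exact h₁
      · fin_cases i
        · exact h₂.symm
        · exact hs'
    · rintro ⟨x, hx, rfl⟩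
      refine ⟨hx, rfl, ?_⟩
      change (x 1 ^ (2 * k + 1)) ^ 2 = (x 1 ^ 2) ^ (2 * k + 1)
      rw [← pow_mul, ← pow_mul, mul_comm]
  have han : IsAnalyticSubset ((M : Set (Fin 2 → ℂ)) ×ˢ Set.univ)
      ((I2 (2 * k + 3)).spectrum M) := by
    convert isAnalyticSubset_zeros (isOpen_cotangent (M := M))
      ![fun p => p.2 0 - 1, fun p => p.2 1 ^ 2 - p.1 1 ^ (2 * k + 1)] ?_ using 1
    · ext p
      simp [mem_spectrum_I2, hm, Fin.forall_fin_two, sub_eq_zero]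
    · intro i p _
      fin_cases i <;> exact ContDiffAt.analyticAt (by dsimp; fun_prop)
  rw [himage] at han ⊢
  refine isIrreducibleAnalyticSubset_image (M.isOpen.preimage contDiff_squareSnd.continuous)
    (isConnected_preimage_squareSnd hM h0) (fun x _ => ?_) han
  refine contDiff_squareSnd.contDiffAt.analyticAt.prod (analyticAt_pi_iff.2 fun i => ?_)
  fin_cases i
  · exact analyticAt_const
  · exact ContDiffAt.analyticAt (by dsimp; fun_prop)

end Spectrum

/-! ### Exponents of the normal form. -/

section NormalForm

variable {M : TopologicalSpace.Opens (Fin 2 → ℂ)}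
  {H : Base M → Type*} [TopologicalSpace (Bundle.TotalSpace (Fin 2 → ℂ) H)]
  [∀ x, AddCommGroup (H x)] [∀ x, Module ℂ (H x)] [∀ x, TopologicalSpace (H x)]
  [FiberBundle (Fin 2 → ℂ) H]

/-- The exponent at the sheet `y = (1, s)` of the spectrum, in the normal form. -/
noncomputable def normalExponent (m : ℕ) (α lam : ℂ) (t : Fin 2 → ℂ) (s : ℂ) : ℂ :=
  α - t 1 * normalF m lam t / (m * s)

theorem formallyDecomposes_normalForm {S : TEStructure 2 H} {m : ℕ} (hm : m ≠ 0) {V : Set ℂ}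
    (hV : IsOpen V) (h0V : (0 : ℂ) ∈ V) {v : Fin 2 → ∀ x, H x} {α lam : ℂ}
    (hv : HolBasis 2 v {x | x.1.1 ∈ V})
    (hvn : S.HasMatrices v {x | x.1.1 ∈ V} (normalA m lam) (normalB m α lam))
    (t : M) (ht : (t : Fin 2 → ℂ) 1 ≠ 0) {s : ℂ} (hs : s ^ 2 = (t : Fin 2 → ℂ) 1 ^ (m - 2)) :
    S.FormallyDecomposes t
      ![(t : Fin 2 → ℂ) 0 + 2 / m * (t : Fin 2 → ℂ) 1 * s,
        (t : Fin 2 → ℂ) 0 - 2 / m * (t : Fin 2 → ℂ) 1 * s]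
      ![normalExponent m α lam t s, normalExponent m α lam t (-s)] := by
  have hm' : (m : ℂ) ≠ 0 := Nat.cast_ne_zero.2 hm
  have hs0 : s ≠ 0 := by
    rintro rfl
    exact pow_ne_zero (m - 2) ht (by simpa using hs.symm)
  obtain ⟨t, htM⟩ := t
  dsimp only at *
  obtain ⟨T, hT, hg⟩ := exists_isFormalGauge_linear
    ![t 0 + 2 / m * t 1 * s, t 0 - 2 / m * t 1 * s]
    (b₀ := (-t 0) • (1 : Matrix (Fin 2) (Fin 2) ℂ) - (2 / (m : ℂ) * t 1) • matC2 m t)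
    (b₁ := α • (1 : Matrix (Fin 2) (Fin 2) ℂ) + ((2 - (m : ℂ)) / (2 * (m : ℂ))) • matD +
      (-2 / (m : ℂ) * t 1 * normalF m lam t) • matE)
    -- The columns are eigenvectors of `matC2` for `s` and `-s`.
    (P := !![s, -s; 1, 1])
    -- This is `P⁻¹ b₁ P`: `matD` sends `(s, 1)` to `-(-s, 1)`, so it is off-diagonal, and `matE`
    -- sends it to `(1, 0) = ((s, 1) - (-s, 1)) / (2s)`.
    (N := !![normalExponent m α lam t s,
        -((2 - (m : ℂ)) / (2 * (m : ℂ))) - t 1 * normalF m lam t / (m * s);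
        -((2 - (m : ℂ)) / (2 * (m : ℂ))) + t 1 * normalF m lam t / (m * s),
        normalExponent m α lam t (-s)])
    (by
      intro h
      have : 4 / (m : ℂ) * t 1 * s = 0 := by
        simp only [Matrix.cons_val_zero, Matrix.cons_val_one] at h
        linear_combination h
      simp [hm', ht, hs0] at this)
    (by
      rw [Matrix.isUnit_iff_isUnit_det, Matrix.det_fin_two_of, isUnit_iff_ne_zero]
      intro h
      exact hs0 (by linear_combination h / 2))
    (by
      ext i j
      fin_cases i <;> fin_cases j <;>
        simp [Matrix.mul_apply, Fin.sum_univ_two, matC2, ← hs, Matrix.diagonal, Matrix.one_apply]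
        <;> ring)
    (by
      ext i j
      fin_cases i <;> fin_cases j <;>
        simp [Matrix.mul_apply, Fin.sum_univ_two, matD, matE, normalExponent, Matrix.one_apply]
        <;> field_simp <;> ring)
  refine ⟨{x | x.1.1 ∈ V}, v, fun z => normalB m α lam z t, T,
    hV.preimage (continuous_fst.comp continuous_subtype_val), h0V, hv, ?_, ?_, hT, ?_⟩
  · intro i j
    simp only [normalB, Matrix.add_apply, Matrix.smul_apply, smul_eq_mul]
    fun_prop
  · intro z hz j
    exact (hvn _ hz j).2
  · rw [← taylor_linear] at hg
    have hdiag : (fun i => !![normalExponent m α lam t s,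
        -((2 - (m : ℂ)) / (2 * (m : ℂ))) - t 1 * normalF m lam t / (m * s);
        -((2 - (m : ℂ)) / (2 * (m : ℂ))) + t 1 * normalF m lam t / (m * s),
        normalExponent m α lam t (-s)] i i) =
        ![normalExponent m α lam t s, normalExponent m α lam t (-s)] := by
      ext i
      fin_cases i <;> rfl
    rw [hdiag] at hg
    exact hg

variable [VectorBundle ℂ (Fin 2 → ℂ) H]
  [ContMDiffVectorBundle ω (Fin 2 → ℂ) H 𝓘(ℂ, ℂ × (Fin 2 → ℂ))]

theorem TEStructure.FormallyDecomposes.hasExponents {S : TEStructure 2 H} {t : M}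
    {u α : Fin 2 → ℂ} (h : S.FormallyDecomposes t u α) : S.HasExponents t {α 0, α 1} := by
  refine ⟨⟨u, α, h⟩, fun u' α' h' => ?_⟩
  obtain ⟨σ, -, rfl⟩ := h.exists_perm h'
  have : Finset.univ.val.map (α ∘ σ) = Finset.univ.val.map α := by
    rw [← Multiset.map_map, Multiset.map_univ_val_equiv]
  rw [this]
  rfl

/-- Distinct eigenvalues tie each exponent to its sheet, so permuting the rank 1 pieces does not
change the answer. -/
theorem TEStructure.FormallyDecomposes.isExponentAt_iff {S : TEStructure 2 H} {t : M}
    {F : TangentData 2} {y u α : Fin 2 → ℂ} (h : S.FormallyDecomposes t u α)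
    (hu : Function.Injective u) {i : Fin 2}
    (hi : u i = ∑ k, F.euler t k * y k) (γ : ℂ) : S.IsExponentAt F t y γ ↔ γ = α i := by
  constructor
  · rintro ⟨u', α', h', j, hj, rfl⟩
    obtain ⟨σ, rfl, rfl⟩ := h.exists_perm h'
    have : σ j = i := hu (hj.trans hi.symm)
    simp [this]
  · rintro rfl
    exact ⟨u, α, h, i, hi, rfl⟩

theorem isExponentAt_normalForm {S : TEStructure 2 H} {m : ℕ} (hm : m ≠ 0) {V : Set ℂ}
    (hV : IsOpen V) (h0V : (0 : ℂ) ∈ V) {v : Fin 2 → ∀ x, H x} {α lam : ℂ}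
    (hv : HolBasis 2 v {x | x.1.1 ∈ V})
    (hvn : S.HasMatrices v {x | x.1.1 ∈ V} (normalA m lam) (normalB m α lam))
    (t : M) (ht : (t : Fin 2 → ℂ) 1 ≠ 0) {y : Fin 2 → ℂ}
    (hy : ((t : Fin 2 → ℂ), y) ∈ (I2 m).spectrum M) (γ : ℂ) :
    S.IsExponentAt (I2 m) t y γ ↔ γ = normalExponent m α lam t (y 1) := by
  obtain ⟨-, hy0, hy1⟩ := mem_spectrum_I2.1 hy
  dsimp only at hy0 hy1
  have hm' : (m : ℂ) ≠ 0 := Nat.cast_ne_zero.2 hm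
  have hs0 : y 1 ≠ 0 := by
    intro h
    rw [h] at hy1
    exact pow_ne_zero (m - 2) ht (by simpa using hy1.symm)
  refine (formallyDecomposes_normalForm hm hV h0V hv hvn t ht hy1).isExponentAt_iff ?_ (i := 0) ?_ γ
  · have hne : (t : Fin 2 → ℂ) 0 + 2 / m * (t : Fin 2 → ℂ) 1 * y 1 ≠
        (t : Fin 2 → ℂ) 0 - 2 / m * (t : Fin 2 → ℂ) 1 * y 1 := by
      intro h
      have : 4 / (m : ℂ) * (t : Fin 2 → ℂ) 1 * y 1 = 0 := by linear_combination h
      simp [hm', ht, hs0] at this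
    intro i j hij
    fin_cases i <;> fin_cases j
    · rfl
    · exact absurd hij hne
    · exact absurd hij.symm hne
    · rfl
  · simp [I2, Fin.sum_univ_two, hy0]

/-- Here `t₂ f = λ t₂^(k+1)` is proportional to the sheet coordinate `c t₂^(k+1)`, so `t₂` cancels.
-/
theorem normalExponent_even (k : ℕ) (α lam : ℂ) {t : Fin 2 → ℂ} (ht : t 1 ≠ 0) {c : ℂ}
    (hc : c ≠ 0) : normalExponent (2 * k + 4) α lam t (c * t 1 ^ (k + 1)) =
      α - lam / (2 * k + 4 : ℕ) / c := by
  have he : Even (2 * k + 4) := ⟨k + 2, by ring⟩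
  have hm' : ((2 * k + 4 : ℕ) : ℂ) ≠ 0 := Nat.cast_ne_zero.2 (by omega)
  rw [normalExponent, normalF, if_pos he, show (2 * k + 4 - 4) / 2 = k by omega]
  field_simp
  ring

theorem normalExponent_odd (k : ℕ) (α lam : ℂ) (t : Fin 2 → ℂ) (s : ℂ) :
    normalExponent (2 * k + 3) α lam t s = α := by
  have ho : ¬ Even (2 * k + 3) := by
    rw [Nat.not_even_iff_odd]
    exact ⟨k + 1, by ring⟩
  simp [normalExponent, normalF, ho]

end NormalForm

end TE

/-! ### The theorem. -/

theorem theorem8p6 (m : ℕ) (hm : 3 ≤ m)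
    -- `M` is a representative of the germ `(ℂ², 0)`, and `H → ℂ × M` a holomorphic vector bundle
    (M : TopologicalSpace.Opens (Fin 2 → ℂ)) (hM : IsConnected (M : Set (Fin 2 → ℂ)))
    (h0 : (0 : Fin 2 → ℂ) ∈ M)
    {H : TE.Base M → Type*} [TopologicalSpace (Bundle.TotalSpace (Fin 2 → ℂ) H)]
    [∀ x, AddCommGroup (H x)] [∀ x, Module ℂ (H x)] [∀ x, TopologicalSpace (H x)]
    [FiberBundle (Fin 2 → ℂ) H] [VectorBundle ℂ (Fin 2 → ℂ) H]
    [ContMDiffVectorBundle ω (Fin 2 → ℂ) H 𝓘(ℂ, ℂ × (Fin 2 → ℂ))]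
    (S : TE.TEStructure 2 H) (hS : S.IsOver (TE.I2 m))
    -- `v` is a basis of `H` on `V × M` in which the connection has the normal form
    (V : Set ℂ) (hV : IsOpen V) (h0V : (0 : ℂ) ∈ V) (v : Fin 2 → ∀ x, H x) (α lam : ℂ)
    (hv : TE.HolBasis 2 v {x | x.1.1 ∈ V})
    (hvn : S.HasMatrices v {x | x.1.1 ∈ V} (TE.normalA m lam) (TE.normalB m α lam)) :
    (Even m →
      (∃ L₁ L₂, L₁ ≠ L₂ ∧ (TE.I2 m).spectrumComponents M = {L₁, L₂} ∧
        S.ExponentOn (TE.I2 m) L₁ (α - lam / m) ∧ S.ExponentOn (TE.I2 m) L₂ (α + lam / m)) ∧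
      ∀ t : M, (t : Fin 2 → ℂ) ∉ (TE.I2 m).bifurcationSet M →
        S.HasExponents t {α - lam / m, α + lam / m}) ∧
    (Odd m →
      (∃ L, (TE.I2 m).spectrumComponents M = {L} ∧ S.ExponentOn (TE.I2 m) L α) ∧
      ∀ t : M, (t : Fin 2 → ℂ) ∉ (TE.I2 m).bifurcationSet M → S.HasExponents t {α, α}) := by
  have hm0 : m ≠ 0 := by omega
  obtain ⟨t₁, ht₁, ht₁'⟩ := TE.exists_mem_ne_zero h0
  constructor
  · intro he
    -- An even `m ≥ 3` is at least 4, so `m - 2` and `(m - 4) / 2` involve no truncation.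
    obtain ⟨k, rfl⟩ : ∃ k, m = 2 * k + 4 := by
      obtain ⟨j, hj⟩ := he
      exact ⟨j - 2, by omega⟩
    have hpow : 2 * k + 4 - 2 = (k + 1) * 2 := by omega
    -- Both branches at once: `c = 1` gives `α - λ/m`, and `c = -1` gives `α + λ/m`.
    have hexp : ∀ c : ℂ, c ≠ 0 → c ^ 2 = 1 → S.ExponentOn (TE.I2 (2 * k + 4))
        (TE.branch M (k + 1) c) (α - lam / (2 * k + 4 : ℕ) / c) := by
      intro c hc hc2
      refine ⟨⟨_, ⟨t₁, ht₁, rfl⟩, ht₁, (TE.not_mem_bifurcationSet_I2 hm0 ht₁).2 ht₁'⟩, ?_⟩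
      intro t y hty htb γ
      have ht := (TE.not_mem_bifurcationSet_I2 hm0 t.2).1 htb
      obtain ⟨h₁, h₂, h₃⟩ := TE.mem_branch.1 hty
      dsimp only at h₁ h₂ h₃
      rw [TE.isExponentAt_normalForm hm0 hV h0V hv hvn t ht, h₃,
        TE.normalExponent_even k α lam ht hc]
      refine TE.mem_spectrum_I2.2 ⟨h₁, h₂, ?_⟩
      dsimp only
      rw [h₃, mul_pow, hc2, one_mul, hpow, pow_mul]
    refine ⟨⟨TE.branch M (k + 1) 1, TE.branch M (k + 1) (-1), ?_,
      TE.spectrumComponents_even hM h0 k, ?_, ?_⟩, ?_⟩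
    · intro h
      exact TE.not_branch_subset h0 (k + 1) (by norm_num : (1 : ℂ) ≠ -1) h.subset
    · simpa using hexp 1 one_ne_zero (one_pow 2)
    · simpa [div_neg] using hexp (-1) (neg_ne_zero.2 one_ne_zero) (by norm_num)
    · intro t htb
      have ht := (TE.not_mem_bifurcationSet_I2 hm0 t.2).1 htb
      have := (TE.formallyDecomposes_normalForm hm0 hV h0V hv hvn t ht
        (s := 1 * (t : Fin 2 → ℂ) 1 ^ (k + 1)) (by rw [one_mul, hpow, pow_mul])).hasExponents
      simp only [Matrix.cons_val_zero, Matrix.cons_val_one] at this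
      rw [← neg_mul, TE.normalExponent_even k α lam ht one_ne_zero,
        TE.normalExponent_even k α lam ht (neg_ne_zero.2 one_ne_zero)] at this
      simpa [div_neg] using this
  · intro ho
    obtain ⟨k, rfl⟩ : ∃ k, m = 2 * k + 3 := by
      obtain ⟨j, hj⟩ := ho
      exact ⟨j - 1, by omega⟩
    refine ⟨⟨(TE.I2 (2 * k + 3)).spectrum M,
      TE.components_of_isIrreducible (TE.isIrreducible_spectrum_odd hM h0 k), ?_, ?_⟩, ?_⟩
    · obtain ⟨s, hs⟩ := IsAlgClosed.exists_pow_nat_eq (t₁ 1 ^ (2 * k + 3 - 2)) (n := 2) two_pos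
      exact ⟨(t₁, ![1, s]), TE.mem_spectrum_I2.2 ⟨ht₁, rfl, hs⟩, ht₁,
        (TE.not_mem_bifurcationSet_I2 hm0 ht₁).2 ht₁'⟩
    · intro t y hty htb γ
      have ht := (TE.not_mem_bifurcationSet_I2 hm0 t.2).1 htb
      rw [TE.isExponentAt_normalForm hm0 hV h0V hv hvn t ht hty, TE.normalExponent_odd]
    · intro t htb
      have ht := (TE.not_mem_bifurcationSet_I2 hm0 t.2).1 htb
      obtain ⟨s, hs⟩ := IsAlgClosed.exists_pow_nat_eq
        ((t : Fin 2 → ℂ) 1 ^ (2 * k + 3 - 2)) (n := 2) two_pos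
      simpa [TE.normalExponent_odd] using
        (TE.formallyDecomposes_normalForm hm0 hV h0V hv hvn t ht hs).hasExponents
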